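/- Let $G$ be a discrete group with unit $e$. A Fell bundle over $G$ is a family $\mathcal B=(B_g)_{g\in G}$ of complex Banach spaces with bilinear products $B_g\times B_h\to B_{gh}$ and conjugate-linear involutions $*\colon B_g\to B_{g^{-1}}$ such that the product is associative, $\|ab\|\le\|a\|\|b\|$, $a^{**}=a$, $(ab)^*=b^*a^*$, $\|a^*\|=\|a\|$, $\|a^*a\|=\|a\|^2$, and for every $g$ and $a\in B_g$ the element $a^*a$ is positive in the $C^*$-algebra $B_e$. Let $C_c(\mathcal B)=\bigoplus_g B_g$ be its convolution $*$-algebra of finitely supported sections. The full cross-sectional $C^*$-algebra $C^*(\mathcal B)$ is the completion of $C_c(\mathcal B)$ in its largest $C^*$-seminorm. The reduced cross-sectional $C^*$-algebra $C^*_r(\mathcal B)$ is the completion of $C_c(\mathcal B)$ in the operator norm of its left regular representation (by convolution) on the Hilbert $B_e$-module $\ell^2(\mathcal B)$, the completion of $C_c(\mathcal B)$ for the inner product $\langle\xi,\eta\rangle=\sum_g\xi(g)^*\eta(g)$. Each $B_g$ is regarded as a subspace of both $C^*(\mathcal B)$ and $C^*_r(\mathcal B)$. A representation of $\mathcal B$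 on a Hilbert space $H$ is a family $\pi=(\pi_g)_{g\in G}$ of linear maps $\pi_g\colon B_g\to\mathbb B(H)$ with $\pi_{gh}(ab)=\pi_g(a)\pi_h(b)$ and $\pi_{g^{-1}}(a^*)=\pi_g(a)^*$ for all $g,h\in G$, $a\in B_g$, $b\in B_h$; it is faithful if $\pi_e$ is injective. Proposition. Let $\mathcal B=(B_g)_{g\in G}$ and $\mathcal C=(C_g)_{g\in G}$ be Fell bundles over $G$, and let $\pi=(\pi_g)_{g\in G}$ be a faithful representation of $\mathcal C$ on a Hilbert space $H$. Let $\varphi\colon C^*(\mathcal B)\to\mathbb B(H)$ be a completely positive map with $\varphi(B_g)\subseteq\pi_g(C_g)$ for all $g\in G$. Then there is a completely positive map $\varphi'\colon C^*_r(\mathcal B)\to C^*_r(\mathcal C)$ with $\|\varphi'\|=\|\varphi\|$ (operator norms) such that, for all $g\in G$ and $b\in B_g$, $\varphi'(b)\in C_g$ and $\pi_g(\varphi'(b))=\varphi(b)$. -/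

import Mathlib

noncomputable section

/-- A C*-seminorm on a complex `*`-algebra. -/
structure CStarSeminorm (A : Type*) [NonUnitalRing A] [StarRing A] [Module ℂ A] extends
    Seminorm ℂ A where
  mul_le' : ∀ x y, toFun (x * y) ≤ toFun x * toFun y
  map_star' : ∀ x, toFun (star x) = toFun x
  map_star_mul_self' : ∀ x, toFun (star x * x) = toFun x * toFun x

namespace CStarSeminorm

section Completion

variable {A : Type*} [NonUnitalRing A] [StarRing A] [Module ℂ A]

/-- The `*`-algebra `A`, seminormed by `p`. -/
def Carrier (_p : CStarSeminorm A) : Type _ := A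

variable (p : CStarSeminorm A)

instance : NonUnitalRing p.Carrier := inferInstanceAs (NonUnitalRing A)

instance : NonUnitalSeminormedRing p.Carrier where
  __ := (inferInstance : NonUnitalRing p.Carrier)
  __ := (p.toSeminorm.toSeminormedAddCommGroup : SeminormedAddCommGroup A)
  norm_mul_le := p.mul_le'

instance : StarRing p.Carrier := inferInstanceAs (StarRing A)

instance : NormedSpace ℂ p.Carrier where
  __ := (inferInstanceAs (Module ℂ A) : Module ℂ p.Carrier)
  norm_smul_le c x := (map_smul_eq_mul p.toSeminorm c x).le

instance : NormedStarGroup p.Carrier where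
  norm_star_le x := (p.map_star' x).le

instance [IsScalarTower ℂ A A] : IsScalarTower ℂ p.Carrier p.Carrier :=
  inferInstanceAs (IsScalarTower ℂ A A)
instance [SMulCommClass ℂ A A] : SMulCommClass ℂ p.Carrier p.Carrier :=
  inferInstanceAs (SMulCommClass ℂ A A)
instance [StarModule ℂ A] : StarModule ℂ p.Carrier := inferInstanceAs (StarModule ℂ A)

/-- The Hausdorff completion of a `*`-algebra with respect to a C*-seminorm: the C*-algebra
obtained by dividing out the null space and completing. -/
def Completion : Type _ := UniformSpace.Completion p.Carrier

instance : NormedAddCommGroup p.Completion :=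
  inferInstanceAs (NormedAddCommGroup (UniformSpace.Completion p.Carrier))
instance : NormedSpace ℂ p.Completion :=
  inferInstanceAs (NormedSpace ℂ (UniformSpace.Completion p.Carrier))
instance : CompleteSpace p.Completion :=
  inferInstanceAs (CompleteSpace (UniformSpace.Completion p.Carrier))

/-- The canonical map of `A` to its completion. -/
def toCompletion : A →ₗ[ℂ] p.Completion :=
  (UniformSpace.Completion.toComplₗᵢ (𝕜 := ℂ) (E := p.Carrier)).toLinearMap

theorem norm_toCompletion (x : A) : ‖p.toCompletion x‖ = p.toSeminorm x :=
  UniformSpace.Completion.norm_coe (E := p.Carrier) x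

theorem isDenseInducing_toCompletion : IsDenseInducing (fun x : p.Carrier => p.toCompletion x) :=
  UniformSpace.Completion.isDenseInducing_coe (α := p.Carrier)

theorem denseRange_toCompletion : DenseRange p.toCompletion :=
  UniformSpace.Completion.denseRange_coe (α := p.Carrier)

theorem continuous_toCompletion : Continuous (fun x : p.Carrier => p.toCompletion x) :=
  UniformSpace.Completion.continuous_coe p.Carrier

instance : Mul p.Completion where
  mul x y := (p.isDenseInducing_toCompletion.prodMap p.isDenseInducing_toCompletion).extend
    (fun z : p.Carrier × p.Carrier => p.toCompletion (z.1 * z.2)) (x, y)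

theorem toCompletion_mul (x y : A) : p.toCompletion (x * y) = p.toCompletion x * p.toCompletion y :=
  ((p.isDenseInducing_toCompletion.prodMap p.isDenseInducing_toCompletion).extend_eq
    (f := fun z : p.Carrier × p.Carrier => p.toCompletion (z.1 * z.2))
    (p.continuous_toCompletion.comp (continuous_mul (M := p.Carrier))) (x, y)).symm

instance : ContinuousMul p.Completion where
  continuous_mul := by
    let e : p.Carrier →+ p.Completion := (p.toCompletion).toAddMonoidHom
    let m : p.Carrier →+ p.Carrier →+ p.Completion :=
      (AddMonoidHom.mul : p.Carrier →+ p.Carrier →+ p.Carrier).compr₂ e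
    have hm : Continuous fun z : p.Carrier × p.Carrier => m z.1 z.2 :=
      p.continuous_toCompletion.comp (continuous_mul (M := p.Carrier))
    have di : IsDenseInducing e := p.isDenseInducing_toCompletion
    exact (di.extend_Z_bilin di hm :)

instance : Star p.Completion where
  star := UniformSpace.Completion.map (fun x : p.Carrier => star x)

theorem uniformContinuous_star_carrier : UniformContinuous (fun x : p.Carrier => star x) :=
  uniformContinuous_addMonoidHom_of_continuous (f := (starAddEquiv : p.Carrier ≃+ p.Carrier))
    (continuous_star (R := p.Carrier))

theorem toCompletion_star (x : A) : p.toCompletion (star x) = star (p.toCompletion x) :=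
  (UniformSpace.Completion.map_coe p.uniformContinuous_star_carrier x).symm

instance : ContinuousStar p.Completion where
  continuous_star := UniformSpace.Completion.continuous_map

theorem induction_on {P : p.Completion → Prop} (x : p.Completion) (hP : IsClosed {x | P x})
    (h : ∀ a, P (p.toCompletion a)) : P x :=
  UniformSpace.Completion.induction_on x hP h

theorem continuous_mul_right (y : p.Completion) : Continuous fun x : p.Completion => x * y :=
  continuous_mul.comp (continuous_id.prodMk continuous_const)

theorem continuous_mul_left (x : p.Completion) : Continuous fun y : p.Completion => x * y :=
  continuous_mul.comp (continuous_const.prodMk continuous_id)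

theorem induction_on₂ {P : p.Completion → p.Completion → Prop} (x y : p.Completion)
    (h₁ : ∀ y, IsClosed {x | P x y}) (h₂ : ∀ x, IsClosed {y | P x y})
    (h : ∀ a b, P (p.toCompletion a) (p.toCompletion b)) : P x y :=
  p.induction_on x (h₁ y) fun a => p.induction_on y (h₂ _) fun b => h a b

theorem mul_assoc' (x y z : p.Completion) : x * y * z = x * (y * z) := by
  refine p.induction_on₂ (P := fun x y => x * y * z = x * (y * z)) x y (fun y => isClosed_eq
    ((p.continuous_mul_right z).comp (p.continuous_mul_right y)) (p.continuous_mul_right (y * z)))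
    (fun x => isClosed_eq ((p.continuous_mul_right z).comp (p.continuous_mul_left x))
    ((p.continuous_mul_left x).comp (p.continuous_mul_right z))) fun a b => ?_
  refine p.induction_on (P := fun z => p.toCompletion a * p.toCompletion b * z =
    p.toCompletion a * (p.toCompletion b * z)) z (isClosed_eq
    (p.continuous_mul_left _) ((p.continuous_mul_left _).comp (p.continuous_mul_left _))) fun c => ?_
  simp only [← toCompletion_mul, mul_assoc]

theorem left_distrib' (x y z : p.Completion) : x * (y + z) = x * y + x * z := by
  refine p.induction_on₂ (P := fun y z => x * (y + z) = x * y + x * z) y z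
    (fun z => isClosed_eq ((p.continuous_mul_left x).comp (continuous_id.add continuous_const))
      ((p.continuous_mul_left x).add continuous_const))
    (fun y => isClosed_eq ((p.continuous_mul_left x).comp (continuous_const.add continuous_id))
      (continuous_const.add (p.continuous_mul_left x))) fun b c => ?_
  refine p.induction_on (P := fun x => x * (p.toCompletion b + p.toCompletion c) =
    x * p.toCompletion b + x * p.toCompletion c) x (isClosed_eq (p.continuous_mul_right _)
    ((p.continuous_mul_right _).add (p.continuous_mul_right _))) fun a => ?_
  simp only [← map_add, ← toCompletion_mul, mul_add]

theorem right_distrib' (x y z : p.Completion) : (x + y) * z = x * z + y * z := by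
  refine p.induction_on₂ (P := fun x y => (x + y) * z = x * z + y * z) x y
    (fun y => isClosed_eq ((p.continuous_mul_right z).comp (continuous_id.add continuous_const))
      ((p.continuous_mul_right z).add continuous_const))
    (fun x => isClosed_eq ((p.continuous_mul_right z).comp (continuous_const.add continuous_id))
      (continuous_const.add (p.continuous_mul_right z))) fun a b => ?_
  refine p.induction_on (P := fun z => (p.toCompletion a + p.toCompletion b) * z =
    p.toCompletion a * z + p.toCompletion b * z) z (isClosed_eq (p.continuous_mul_left _)
    ((p.continuous_mul_left _).add (p.continuous_mul_left _))) fun c => ?_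
  simp only [← map_add, ← toCompletion_mul, add_mul]

theorem norm_mul_le' (x y : p.Completion) : ‖x * y‖ ≤ ‖x‖ * ‖y‖ := by
  refine p.induction_on₂ (P := fun x y => ‖x * y‖ ≤ ‖x‖ * ‖y‖) x y
    (fun y => isClosed_le (p.continuous_mul_right y).norm (continuous_norm.mul continuous_const))
    (fun x => isClosed_le (p.continuous_mul_left x).norm (continuous_const.mul continuous_norm))
    fun a b => ?_
  rw [← toCompletion_mul, norm_toCompletion, norm_toCompletion, norm_toCompletion]
  exact p.mul_le' a b

theorem zero_mul' (x : p.Completion) : 0 * x = 0 := by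
  refine p.induction_on (P := fun x => 0 * x = 0) x
    (isClosed_eq (p.continuous_mul_left _) continuous_const) fun a => ?_
  rw [← map_zero p.toCompletion, ← toCompletion_mul, zero_mul]

theorem mul_zero' (x : p.Completion) : x * 0 = 0 := by
  refine p.induction_on (P := fun x => x * 0 = 0) x
    (isClosed_eq (p.continuous_mul_right _) continuous_const) fun a => ?_
  rw [← map_zero p.toCompletion, ← toCompletion_mul, mul_zero]

theorem star_star' (x : p.Completion) : star (star x) = x := by
  refine p.induction_on (P := fun x => star (star x) = x) x
    (isClosed_eq (continuous_star.comp continuous_star) continuous_id) fun a => ?_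
  rw [← toCompletion_star, ← toCompletion_star, star_star]

theorem star_mul' (x y : p.Completion) : star (x * y) = star y * star x := by
  refine p.induction_on₂ (P := fun x y => star (x * y) = star y * star x) x y
    (fun y => isClosed_eq (continuous_star.comp (p.continuous_mul_right y))
      ((p.continuous_mul_left _).comp continuous_star))
    (fun x => isClosed_eq (continuous_star.comp (p.continuous_mul_left x))
      ((p.continuous_mul_right _).comp continuous_star)) fun a b => ?_
  simp only [← toCompletion_star, ← toCompletion_mul, star_mul]

theorem star_add' (x y : p.Completion) : star (x + y) = star x + star y := by
  refine p.induction_on₂ (P := fun x y => star (x + y) = star x + star y) x y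
    (fun y => isClosed_eq (continuous_star.comp (continuous_id.add continuous_const))
      (continuous_star.add continuous_const))
    (fun x => isClosed_eq (continuous_star.comp (continuous_const.add continuous_id))
      (continuous_const.add continuous_star)) fun a b => ?_
  simp only [← toCompletion_star, ← map_add, star_add]

theorem norm_star_mul_self' (x : p.Completion) : ‖star x * x‖ = ‖x‖ * ‖x‖ := by
  refine p.induction_on (P := fun x => ‖star x * x‖ = ‖x‖ * ‖x‖) x
    (isClosed_eq (continuous_mul.comp (continuous_star.prodMk continuous_id)).norm
      (continuous_norm.mul continuous_norm)) fun a => ?_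
  rw [← toCompletion_star, ← toCompletion_mul, norm_toCompletion, norm_toCompletion]
  exact p.map_star_mul_self' a

theorem smul_mul' [IsScalarTower ℂ A A] (c : ℂ) (x y : p.Completion) :
    (c • x) * y = c • (x * y) := by
  refine p.induction_on₂ (P := fun x y => (c • x) * y = c • (x * y)) x y
    (fun y => isClosed_eq ((p.continuous_mul_right y).comp (continuous_const_smul c))
      ((continuous_const_smul c).comp (p.continuous_mul_right y)))
    (fun x => isClosed_eq (p.continuous_mul_left _)
      ((continuous_const_smul c).comp (p.continuous_mul_left x))) fun a b => ?_
  simp only [← map_smul, ← toCompletion_mul, smul_mul_assoc]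

theorem mul_smul' [SMulCommClass ℂ A A] (c : ℂ) (x y : p.Completion) :
    x * (c • y) = c • (x * y) := by
  refine p.induction_on₂ (P := fun x y => x * (c • y) = c • (x * y)) x y
    (fun y => isClosed_eq (p.continuous_mul_right _)
      ((continuous_const_smul c).comp (p.continuous_mul_right y)))
    (fun x => isClosed_eq ((p.continuous_mul_left x).comp (continuous_const_smul c))
      ((continuous_const_smul c).comp (p.continuous_mul_left x))) fun a b => ?_
  simp only [← map_smul, ← toCompletion_mul, mul_smul_comm]

theorem star_smul' [StarModule ℂ A] (c : ℂ) (x : p.Completion) :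
    star (c • x) = star c • star x := by
  refine p.induction_on (P := fun x => star (c • x) = star c • star x) x
    (isClosed_eq (continuous_star.comp (continuous_const_smul c))
      ((continuous_const_smul (star c)).comp continuous_star)) fun a => ?_
  simp only [← toCompletion_star, ← map_smul, star_smul]

instance : NonUnitalNormedRing p.Completion where
  __ := (inferInstance : NormedAddCommGroup p.Completion)
  left_distrib := p.left_distrib'
  right_distrib := p.right_distrib'
  mul_assoc := p.mul_assoc'
  zero_mul := p.zero_mul'
  mul_zero := p.mul_zero'
  norm_mul_le := p.norm_mul_le'

instance : StarRing p.Completion where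
  star_involutive := p.star_star'
  star_mul := p.star_mul'
  star_add := p.star_add'

instance [IsScalarTower ℂ A A] [SMulCommClass ℂ A A] [StarModule ℂ A] :
    NonUnitalCStarAlgebra p.Completion where
  __ := (inferInstance : NonUnitalNormedRing p.Completion)
  __ := (inferInstance : NormedSpace ℂ p.Completion)
  __ := (inferInstance : CompleteSpace p.Completion)
  __ := (inferInstance : StarRing p.Completion)
  norm_mul_self_le x := (p.norm_star_mul_self' x).ge
  smul_assoc c x y := p.smul_mul' c x y
  smul_comm c x y := (p.mul_smul' c x y).symm
  star_smul := p.star_smul'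

/-- The usual order of a C*-algebra. -/
instance [IsScalarTower ℂ A A] [SMulCommClass ℂ A A] [StarModule ℂ A] :
    PartialOrder p.Completion := CStarAlgebra.spectralOrder _

instance [IsScalarTower ℂ A A] [SMulCommClass ℂ A A] [StarModule ℂ A] :
    StarOrderedRing p.Completion := CStarAlgebra.spectralOrderedRing _

end Completion

end CStarSeminorm

namespace CStarSeminorm

variable {A : Type*} [NonUnitalRing A] [StarRing A] [Module ℂ A]

instance : Inhabited (CStarSeminorm A) :=
  ⟨{ (0 : Seminorm ℂ A) with
      mul_le' := fun _ _ => (mul_zero (0 : ℝ)).ge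
      map_star' := fun _ => rfl
      map_star_mul_self' := fun _ => (mul_zero (0 : ℝ)).symm }⟩

theorem nonneg (p : CStarSeminorm A) (x : A) : 0 ≤ p.toSeminorm x := apply_nonneg _ _

/-- The largest C*-seminorm `x ↦ sup {p x | p a C*-seminorm}`, if these suprema are finite. -/
def largest (h : ∀ x, BddAbove (Set.range fun p : CStarSeminorm A => p.toSeminorm x)) :
    CStarSeminorm A where
  toFun x := ⨆ p : CStarSeminorm A, p.toSeminorm x
  map_zero' := by simp
  add_le' x y := ciSup_le fun p => (map_add_le_add p.toSeminorm x y).trans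
    (add_le_add (le_ciSup (h x) p) (le_ciSup (h y) p))
  neg' x := by simp
  smul' c x := by
    simp only [map_smul_eq_mul]
    exact (Real.mul_iSup_of_nonneg (norm_nonneg c) _).symm
  mul_le' x y := ciSup_le fun p => (p.mul_le' x y).trans
    (mul_le_mul (le_ciSup (h x) p) (le_ciSup (h y) p) (p.nonneg y)
      ((p.nonneg x).trans (le_ciSup (h x) p)))
  map_star' x := iSup_congr fun p => p.map_star' x
  map_star_mul_self' x := by
    have hx : ∀ p : CStarSeminorm A, p.toSeminorm x ≤ ⨆ p : CStarSeminorm A, p.toSeminorm x :=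
      fun p => le_ciSup (h x) p
    have h0 : 0 ≤ ⨆ p : CStarSeminorm A, p.toSeminorm x :=
      (default : CStarSeminorm A).nonneg x |>.trans (hx _)
    refine le_antisymm (ciSup_le fun p => ?_) ?_
    · exact (p.map_star_mul_self' x).le.trans (mul_le_mul (hx p) (hx p) (p.nonneg x) h0)
    · have hsq : ∀ p : CStarSeminorm A, p.toSeminorm x ≤
          √(⨆ p : CStarSeminorm A, p.toSeminorm (star x * x)) := fun p =>
        Real.le_sqrt_of_sq_le <| by
          rw [sq]
          exact (p.map_star_mul_self' x).ge.trans (le_ciSup (h (star x * x)) p)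
      have h1 : 0 ≤ ⨆ p : CStarSeminorm A, p.toSeminorm (star x * x) :=
        ((default : CStarSeminorm A).nonneg _).trans (le_ciSup (h (star x * x)) default)
      calc _ ≤ _ := mul_self_le_mul_self h0 (ciSup_le hsq)
        _ = _ := Real.mul_self_sqrt h1

end CStarSeminorm

/-- A Fell bundle over a discrete group `G`: a family of complex Banach spaces `(B_g)`, with an
associative bilinear multiplication `B_g × B_h → B_{gh}` and a conjugate-linear, isometric,
antimultiplicative involution `B_g → B_{g⁻¹}` such that `‖a b‖ ≤ ‖a‖ ‖b‖`, `‖a* a‖ = ‖a‖ ^ 2` and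
`a* a` is positive in the C*-algebra `B_1`. Equations between elements of fibres whose indices are
only propositionally equal are stated in the total space `Σ g, B_g`. -/
structure FellBundle (G : Type*) [Group G] where
  fiber : G → Type*
  [normedAddCommGroup : ∀ g, NormedAddCommGroup (fiber g)]
  [normedSpace : ∀ g, NormedSpace ℂ (fiber g)]
  [completeSpace : ∀ g, CompleteSpace (fiber g)]
  fmul : ∀ {g h : G}, fiber g → fiber h → fiber (g * h)
  fstar : ∀ {g : G}, fiber g → fiber g⁻¹
  add_fmul : ∀ {g h : G} (a a' : fiber g) (b : fiber h), fmul (a + a') b = fmul a b + fmul a' b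
  fmul_add : ∀ {g h : G} (a : fiber g) (b b' : fiber h), fmul a (b + b') = fmul a b + fmul a b'
  smul_fmul : ∀ {g h : G} (c : ℂ) (a : fiber g) (b : fiber h), fmul (c • a) b = c • fmul a b
  fmul_smul : ∀ {g h : G} (c : ℂ) (a : fiber g) (b : fiber h), fmul a (c • b) = c • fmul a b
  fmul_assoc : ∀ {g h k : G} (a : fiber g) (b : fiber h) (c : fiber k),
    (⟨_, fmul (fmul a b) c⟩ : Σ g, fiber g) = ⟨_, fmul a (fmul b c)⟩
  norm_fmul_le : ∀ {g h : G} (a : fiber g) (b : fiber h), ‖fmul a b‖ ≤ ‖a‖ * ‖b‖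
  fstar_add : ∀ {g : G} (a a' : fiber g), fstar (a + a') = fstar a + fstar a'
  fstar_smul : ∀ {g : G} (c : ℂ) (a : fiber g), fstar (c • a) = (starRingEnd ℂ c) • fstar a
  fstar_fstar : ∀ {g : G} (a : fiber g), (⟨_, fstar (fstar a)⟩ : Σ g, fiber g) = ⟨g, a⟩
  fstar_fmul : ∀ {g h : G} (a : fiber g) (b : fiber h),
    (⟨_, fstar (fmul a b)⟩ : Σ g, fiber g) = ⟨_, fmul (fstar b) (fstar a)⟩
  norm_fstar : ∀ {g : G} (a : fiber g), ‖fstar a‖ = ‖a‖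
  norm_fstar_fmul_self : ∀ {g : G} (a : fiber g), ‖fmul (fstar a) a‖ = ‖a‖ ^ 2
  fstar_fmul_self_nonneg : ∀ {g : G} (a : fiber g), ∃ c : fiber 1,
    (⟨_, fmul (fstar a) a⟩ : Σ g, fiber g) = ⟨_, fmul (fstar c) c⟩

namespace FellBundle

open scoped Classical

attribute [instance] normedAddCommGroup normedSpace completeSpace

variable {G : Type*} [Group G] (B : FellBundle G)

/-- The `*`-algebra of finitely supported sections of a Fell bundle, i.e. the algebraic direct sum
`⨁ g, B_g`, under convolution. -/
def Cc : Type _ := Π₀ g, B.fiber g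

namespace Cc

instance : AddCommGroup B.Cc := inferInstanceAs (AddCommGroup (Π₀ g, B.fiber g))
instance : Module ℂ B.Cc := inferInstanceAs (Module ℂ (Π₀ g, B.fiber g))

/-- The section with value `a` at `g` and zero elsewhere. -/
def single (g : G) : B.fiber g →ₗ[ℂ] B.Cc := DFinsupp.lsingle g

/-- The value of a section at `g`. -/
def eval (g : G) : B.Cc →ₗ[ℂ] B.fiber g := DFinsupp.lapply g

variable {B}

theorem eval_single_same (g : G) (a : B.fiber g) : eval B g (single B g a) = a :=
  DFinsupp.single_eq_same (β := B.fiber)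

theorem eval_single_ne {g h : G} (hgh : g ≠ h) (a : B.fiber g) :
    eval B h (single B g a) = 0 :=
  DFinsupp.single_eq_of_ne (β := B.fiber) hgh.symm

theorem single_congr {x y : Σ g, B.fiber g} (h : x = y) : single B x.1 x.2 = single B y.1 y.2 := by
  rw [h]

theorem induction {P : B.Cc → Prop} (f : B.Cc) (h₀ : P 0) (h₁ : ∀ g a, P (single B g a))
    (h₂ : ∀ f f', P f → P f' → P (f + f')) : P f := by
  refine DFinsupp.induction (p := P) f h₀ fun g a f _ _ hf => h₂ _ _ (h₁ g a) hf

/-- The convolution product, determined by the products of the fibres. -/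
def mulₗ (B : FellBundle G) : B.Cc →ₗ[ℂ] B.Cc →ₗ[ℂ] B.Cc :=
  DFinsupp.lsum ℂ fun g => LinearMap.flip (DFinsupp.lsum ℂ fun h => LinearMap.flip
    (LinearMap.mk₂ ℂ (fun (a : B.fiber g) (b : B.fiber h) => single B (g * h) (B.fmul a b))
      (fun a a' b => by rw [B.add_fmul, map_add]) (fun c a b => by rw [B.smul_fmul, map_smul])
      (fun a b b' => by rw [B.fmul_add, map_add]) (fun c a b => by rw [B.fmul_smul, map_smul])))

instance : Mul B.Cc := ⟨fun f f' => mulₗ B f f'⟩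

theorem single_mul_single {g h : G} (a : B.fiber g) (b : B.fiber h) :
    single B g a * single B h b = single B (g * h) (B.fmul a b) := by
  change mulₗ B (DFinsupp.single g a) (DFinsupp.single h b) = _
  unfold mulₗ
  erw [DFinsupp.lsum_single]
  erw [LinearMap.flip_apply]
  erw [DFinsupp.lsum_single]
  rfl

instance : NonUnitalNonAssocRing B.Cc where
  left_distrib f f' f'' := map_add (mulₗ B f) f' f''
  right_distrib f f' f'' := LinearMap.map_add₂ (mulₗ B) f f' f''
  zero_mul f := LinearMap.map_zero₂ (mulₗ B) f
  mul_zero f := map_zero (mulₗ B f)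

instance : NonUnitalRing B.Cc where
  mul_assoc f f' f'' := by
    induction f using Cc.induction with
    | h₀ => simp only [zero_mul]
    | h₂ x y hx hy => simp only [add_mul, hx, hy]
    | h₁ g a =>
    induction f' using Cc.induction with
    | h₀ => simp only [zero_mul, mul_zero]
    | h₂ x y hx hy => simp only [add_mul, mul_add, hx, hy]
    | h₁ h b =>
    induction f'' using Cc.induction with
    | h₀ => simp only [mul_zero]
    | h₂ x y hx hy => simp only [mul_add, hx, hy]
    | h₁ k c =>
    simp only [single_mul_single]
    exact single_congr (B.fmul_assoc a b c)

instance : IsScalarTower ℂ B.Cc B.Cc := ⟨fun c f f' => LinearMap.map_smul₂ (mulₗ B) c f f'⟩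
instance : SMulCommClass ℂ B.Cc B.Cc := ⟨fun c f f' => (map_smul (mulₗ B f) c f').symm⟩

/-- The involution, determined by the involutions of the fibres. -/
def starₗ (B : FellBundle G) : B.Cc →+ B.Cc :=
  DFinsupp.sumAddHom fun g => AddMonoidHom.mk' (fun a : B.fiber g => single B g⁻¹ (B.fstar a))
    fun a a' => by rw [B.fstar_add, map_add]

instance : Star B.Cc := ⟨starₗ B⟩

theorem star_single {g : G} (a : B.fiber g) :
    star (single B g a) = single B g⁻¹ (B.fstar a) :=
  DFinsupp.sumAddHom_single _ _ _

theorem star_zero' : star (0 : B.Cc) = 0 := map_zero (starₗ B)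
theorem star_add' (f f' : B.Cc) : star (f + f') = star f + star f' := map_add (starₗ B) f f'

instance : StarRing B.Cc where
  star_involutive f := by
    induction f using Cc.induction with
    | h₀ => simp only [star_zero']
    | h₂ x y hx hy => simp only [star_add', hx, hy]
    | h₁ g a => simp only [star_single]; exact single_congr (B.fstar_fstar a)
  star_add := star_add'
  star_mul f f' := by
    induction f using Cc.induction with
    | h₀ => simp only [star_zero', zero_mul, mul_zero]
    | h₂ x y hx hy => simp only [add_mul, mul_add, star_add', hx, hy]
    | h₁ g a =>
    induction f' using Cc.induction with
    | h₀ => simp only [star_zero', zero_mul, mul_zero]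
    | h₂ x y hx hy => simp only [add_mul, mul_add, star_add', hx, hy]
    | h₁ h b =>
    simp only [single_mul_single, star_single]
    exact single_congr (B.fstar_fmul a b)

instance : StarModule ℂ B.Cc where
  star_smul c f := by
    induction f using Cc.induction with
    | h₀ => simp
    | h₂ x y hx hy => simp only [smul_add, star_add, hx, hy]
    | h₁ g a => simp only [← map_smul, star_single, B.fstar_smul]; rfl

end Cc

/-- The fibre over the unit, with its structure of a C*-algebra. -/
def unitFiber : Type _ := B.fiber 1

namespace unitFiber

instance : NormedAddCommGroup B.unitFiber := inferInstanceAs (NormedAddCommGroup (B.fiber 1))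
instance : NormedSpace ℂ B.unitFiber := inferInstanceAs (NormedSpace ℂ (B.fiber 1))
instance : CompleteSpace B.unitFiber := inferInstanceAs (CompleteSpace (B.fiber 1))

/-- The inclusion of the unit fibre as sections supported at the unit. -/
def incl : B.unitFiber →ₗ[ℂ] B.Cc := Cc.single B 1

variable {B}

/-- Transport of elements along an equality of indices. -/
def _root_.FellBundle.transport {g h : G} (e : g = h) (a : B.fiber g) : B.fiber h := e ▸ a

theorem _root_.FellBundle.single_transport {g h : G} (e : g = h) (a : B.fiber g) :
    Cc.single B h (FellBundle.transport e a) = Cc.single B g a := by subst e; rfl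

theorem _root_.FellBundle.norm_transport {g h : G} (e : g = h) (a : B.fiber g) :
    ‖FellBundle.transport e a‖ = ‖a‖ := by subst e; rfl

theorem _root_.FellBundle.norm_transport_fmul {g h k : G} (e : g = h) (a : B.fiber g)
    (b : B.fiber k) : ‖B.fmul (FellBundle.transport e a) b‖ = ‖B.fmul a b‖ := by subst e; rfl

instance : Mul B.unitFiber := ⟨fun a b => FellBundle.transport (mul_one 1) (B.fmul (g := 1) (h := 1) a b)⟩
instance : Star B.unitFiber := ⟨fun a => FellBundle.transport inv_one (B.fstar (g := 1) a)⟩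

theorem incl_mul (a b : B.unitFiber) : incl B (a * b) = incl B a * incl B b :=
  (single_transport _ _).trans (Cc.single_mul_single _ _).symm

theorem incl_star (a : B.unitFiber) : incl B (star a) = star (incl B a) :=
  (single_transport _ _).trans (Cc.star_single _).symm

theorem incl_injective : Function.Injective (incl B) :=
  fun _ _ h => DFinsupp.single_injective (β := B.fiber) (i := 1) h

instance : NonUnitalNormedRing B.unitFiber where
  __ := (inferInstance : NormedAddCommGroup B.unitFiber)
  left_distrib a b c := incl_injective <| by simp only [incl_mul, map_add, mul_add]
  right_distrib a b c := incl_injective <| by simp only [incl_mul, map_add, add_mul]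
  zero_mul a := incl_injective <| by simp only [incl_mul, map_zero, zero_mul]
  mul_zero a := incl_injective <| by simp only [incl_mul, map_zero, mul_zero]
  mul_assoc a b c := incl_injective <| by simp only [incl_mul, mul_assoc]
  norm_mul_le a b := (norm_transport _ _).trans_le (B.norm_fmul_le (g := 1) (h := 1) a b)

instance : StarRing B.unitFiber where
  star_involutive a := incl_injective <| by simp only [incl_star, star_star]
  star_mul a b := incl_injective <| by simp only [incl_star, incl_mul, star_mul]
  star_add a b := incl_injective <| by simp only [incl_star, map_add, star_add]

instance : NonUnitalCStarAlgebra B.unitFiber where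
  __ := (inferInstance : NonUnitalNormedRing B.unitFiber)
  __ := (inferInstance : NormedSpace ℂ B.unitFiber)
  __ := (inferInstance : CompleteSpace B.unitFiber)
  __ := (inferInstance : StarRing B.unitFiber)
  norm_mul_self_le a := by
    exact ((norm_transport _ _).trans ((norm_transport_fmul _ _ _).trans
      ((B.norm_fstar_fmul_self (g := 1) a).trans (sq _)))).ge
  smul_assoc c a b := incl_injective <| by
    simp only [smul_eq_mul, incl_mul, map_smul, smul_mul_assoc]
  smul_comm c a b := incl_injective <| by
    simp only [smul_eq_mul, incl_mul, map_smul, mul_smul_comm]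
  star_smul c a := incl_injective <| by simp only [incl_star, map_smul, star_smul]

instance : PartialOrder B.unitFiber := CStarAlgebra.spectralOrder _
instance : StarOrderedRing B.unitFiber := CStarAlgebra.spectralOrderedRing _

end unitFiber

section Full

variable {B}

/-- The restriction of a C*-seminorm to the unit fibre. -/
def restrictUnit (p : CStarSeminorm B.Cc) : CStarSeminorm B.unitFiber where
  __ := p.toSeminorm.comp (unitFiber.incl B)
  mul_le' a b := by
    change p.toSeminorm (unitFiber.incl B (a * b)) ≤ _
    rw [unitFiber.incl_mul]
    exact p.mul_le' _ _
  map_star' a := by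
    change p.toSeminorm (unitFiber.incl B (star a)) = _
    rw [unitFiber.incl_star]
    exact p.map_star' _
  map_star_mul_self' a := by
    change p.toSeminorm (unitFiber.incl B (star a * a)) = _
    rw [unitFiber.incl_mul, unitFiber.incl_star]
    exact p.map_star_mul_self' _

theorem seminorm_incl_le (p : CStarSeminorm B.Cc) (a : B.unitFiber) :
    p.toSeminorm (unitFiber.incl B a) ≤ ‖a‖ := by
  let q := restrictUnit p
  let F : B.unitFiber →⋆ₙₐ[ℂ] q.Completion :=
    { q.toCompletion with
      map_zero' := map_zero q.toCompletion
      map_mul' := q.toCompletion_mul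
      map_star' := q.toCompletion_star }
  exact (q.norm_toCompletion a).ge.trans (NonUnitalStarAlgHom.norm_apply_le F a)

theorem seminorm_single_le (p : CStarSeminorm B.Cc) {g : G} (a : B.fiber g) :
    p.toSeminorm (Cc.single B g a) ≤ ‖a‖ := by
  have h := seminorm_incl_le p (transport (inv_mul_cancel g) (B.fmul (B.fstar a) a))
  have h₁ : p.toSeminorm (Cc.single B 1 (transport (inv_mul_cancel g) (B.fmul (B.fstar a) a))) =
      p.toSeminorm (Cc.single B g a) * p.toSeminorm (Cc.single B g a) := by
    rw [single_transport, ← Cc.single_mul_single, ← Cc.star_single]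
    exact p.map_star_mul_self' _
  have h₂ := (norm_transport (inv_mul_cancel g) (B.fmul (B.fstar a) a)).trans
    (B.norm_fstar_fmul_self a)
  exact le_of_sq_le_sq ((sq _).trans_le (h₁.ge.trans (h.trans h₂.le))) (norm_nonneg a)

theorem bddAbove_seminorms (f : B.Cc) :
    BddAbove (Set.range fun p : CStarSeminorm B.Cc => p.toSeminorm f) := by
  suffices h : ∃ C, ∀ p : CStarSeminorm B.Cc, p.toSeminorm f ≤ C by
    obtain ⟨C, hC⟩ := h
    exact ⟨C, by rintro _ ⟨p, rfl⟩; exact hC p⟩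
  induction f using Cc.induction with
  | h₀ => exact ⟨0, fun p => (map_zero p.toSeminorm).le⟩
  | h₁ g a => exact ⟨‖a‖, fun p => seminorm_single_le p a⟩
  | h₂ f f' hf hf' =>
    obtain ⟨C, hC⟩ := hf
    obtain ⟨C', hC'⟩ := hf'
    exact ⟨C + C', fun p => (map_add_le_add p.toSeminorm f f').trans (add_le_add (hC p) (hC' p))⟩

variable (B)

/-- The largest C*-seminorm on the `*`-algebra of finitely supported sections. -/
def fullSeminorm : CStarSeminorm B.Cc := CStarSeminorm.largest bddAbove_seminorms

/-- The (full) cross-sectional C*-algebra `C*(B)`. -/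
abbrev FullCStar : Type _ := B.fullSeminorm.Completion

/-- The canonical map `B_g → C*(B)`. -/
def toFull (g : G) : B.fiber g →ₗ[ℂ] B.FullCStar :=
  B.fullSeminorm.toCompletion ∘ₗ Cc.single B g

end Full

section Reduced

/-- The value of a section at the unit, as an element of the C*-algebra `B_1`. -/
def evalUnit : B.Cc →ₗ[ℂ] B.unitFiber := Cc.eval B 1

variable {B} in
/-- The element `a* b` of `B_1`, for `a` and `b` in the same fibre. -/
def starMul {g : G} (a b : B.fiber g) : B.unitFiber :=
  transport (inv_mul_cancel g) (B.fmul (B.fstar a) b)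

/-- The `B_1`-valued inner product `⟨ξ, η⟩ = ∑ g, (ξ g)* (η g)` of finitely supported sections. -/
def inner (ξ η : B.Cc) : B.unitFiber := B.evalUnit (star ξ * η)

variable {B}

theorem inner_add_right (ξ η η' : B.Cc) : B.inner ξ (η + η') = B.inner ξ η + B.inner ξ η' := by
  unfold inner; rw [mul_add, map_add]

theorem inner_add_left (ξ ξ' η : B.Cc) : B.inner (ξ + ξ') η = B.inner ξ η + B.inner ξ' η := by
  unfold inner; rw [star_add, add_mul, map_add]

theorem inner_smul_right (c : ℂ) (ξ η : B.Cc) : B.inner ξ (c • η) = c • B.inner ξ η := by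
  unfold inner; rw [mul_smul_comm, map_smul]

theorem inner_zero_left (η : B.Cc) : B.inner 0 η = 0 := by
  unfold inner; rw [star_zero, zero_mul, map_zero]

theorem inner_mul_left (f ξ η : B.Cc) : B.inner ξ (f * η) = B.inner (star f * ξ) η := by
  unfold inner; rw [star_mul, star_star, mul_assoc]

theorem eval_single {g h : G} (e : g = h) (a : B.fiber g) :
    Cc.eval B h (Cc.single B g a) = transport e a := by
  subst e; exact Cc.eval_single_same g a

theorem evalUnit_single_one (a : B.fiber 1) : B.evalUnit (Cc.single B 1 a) = a :=
  Cc.eval_single_same 1 a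

theorem evalUnit_single {g : G} (e : g = 1) (a : B.fiber g) :
    B.evalUnit (Cc.single B g a) = transport e a := eval_single e a

theorem evalUnit_single_ne {g : G} (hg : g ≠ 1) (a : B.fiber g) :
    B.evalUnit (Cc.single B g a) = 0 := Cc.eval_single_ne hg a

theorem evalUnit_star (f : B.Cc) : B.evalUnit (star f) = star (B.evalUnit f) := by
  induction f using Cc.induction with
  | h₀ => rw [star_zero, map_zero, star_zero]
  | h₂ f f' hf hf' => rw [star_add, map_add, map_add, hf, hf', star_add]
  | h₁ g a =>
    rw [Cc.star_single]
    by_cases hg : g = 1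
    · subst hg
      rw [evalUnit_single inv_one, evalUnit_single_one]; rfl
    · rw [evalUnit_single_ne hg, evalUnit_single_ne (by simpa using hg), star_zero]

theorem evalUnit_mul_incl (f : B.Cc) (a : B.unitFiber) :
    B.evalUnit (f * unitFiber.incl B a) = B.evalUnit f * a := by
  induction f using Cc.induction with
  | h₀ => rw [zero_mul, map_zero, zero_mul]
  | h₂ f f' hf hf' => rw [add_mul, map_add, map_add, hf, hf', add_mul]
  | h₁ g b =>
    have hm : Cc.single B g b * unitFiber.incl B a =
      Cc.single B (g * 1) (B.fmul (h := 1) b a) := Cc.single_mul_single (h := 1) b a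
    rw [hm]
    by_cases hg : g = 1
    · subst hg
      rw [evalUnit_single (mul_one 1), evalUnit_single_one]; rfl
    · rw [evalUnit_single_ne hg, evalUnit_single_ne (by simpa using hg), zero_mul]

theorem inner_mul_incl (ξ η : B.Cc) (a : B.unitFiber) :
    B.inner ξ (η * unitFiber.incl B a) = B.inner ξ η * a := by
  unfold inner; rw [← mul_assoc]; exact evalUnit_mul_incl _ _

theorem star_inner (ξ η : B.Cc) : Star.star (B.inner ξ η) = B.inner η ξ := by
  unfold inner; rw [← evalUnit_star, star_mul, star_star]

theorem inner_single (g : G) (a : B.fiber g) (η : B.Cc) :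
    B.inner (Cc.single B g a) η = starMul a (Cc.eval B g η) := by
  unfold inner starMul
  have ht : ∀ {h k : G} (e : h = k) (b b' : B.fiber h),
      transport e (b + b') = transport e b + transport e b' := by
    intro h k e b b'; subst e; rfl
  have h0 : ∀ {h k : G} (e : h = k), transport e (0 : B.fiber h) = 0 := by
    intro h k e; subst e; rfl
  have hz : ∀ {h k : G} (b : B.fiber h), B.fmul b (0 : B.fiber k) = 0 := by
    intro h k b
    simpa using B.fmul_smul 0 b (0 : B.fiber k)
  induction η using Cc.induction with
  | h₀ => rw [mul_zero, map_zero, map_zero, hz, h0]; rfl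
  | h₂ f f' hf hf' => rw [mul_add, map_add, map_add, hf, hf', B.fmul_add, ht]; rfl
  | h₁ k b =>
    rw [Cc.star_single, Cc.single_mul_single]
    by_cases hk : k = g
    · subst hk
      rw [evalUnit_single (inv_mul_cancel k), Cc.eval_single_same]
    · rw [evalUnit_single_ne, Cc.eval_single_ne hk, hz, h0]
      · rfl
      rw [Ne, inv_mul_eq_one]
      exact Ne.symm hk

/-- The finite set of indices at which a section does not vanish. -/
def _root_.FellBundle.Cc.support (ξ : B.Cc) : Finset G := DFinsupp.support (β := B.fiber) ξ

theorem sum_single_support (ξ : B.Cc) :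
    ∑ g ∈ ξ.support, Cc.single B g (Cc.eval B g ξ) = ξ :=
  DFinsupp.sum_single (β := B.fiber) (f := ξ)

theorem inner_eq_sum (ξ η : B.Cc) : B.inner ξ η = ∑ g ∈ ξ.support,
    starMul (Cc.eval B g ξ) (Cc.eval B g η) := by
  conv_lhs => rw [← sum_single_support ξ]
  have h : ∀ s : Finset G, B.inner (∑ g ∈ s, Cc.single B g (Cc.eval B g ξ)) η =
      ∑ g ∈ s, B.inner (Cc.single B g (Cc.eval B g ξ)) η := fun s =>
    map_sum (AddMonoidHom.mk' (fun ξ => B.inner ξ η) fun ξ ξ' => inner_add_left ξ ξ' η) _ s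
  rw [h]
  exact Finset.sum_congr rfl fun g _ => inner_single g _ η

theorem norm_starMul_self {g : G} (a : B.fiber g) : ‖starMul a a‖ = ‖a‖ ^ 2 :=
  (norm_transport (inv_mul_cancel g) _).trans (B.norm_fstar_fmul_self a)

theorem starMul_self_nonneg {g : G} (a : B.fiber g) :
    0 ≤ starMul a a := by
  obtain ⟨c, hc⟩ := B.fstar_fmul_self_nonneg a
  have : starMul a a =
      star (show B.unitFiber from c) * (show B.unitFiber from c) := by
    apply unitFiber.incl_injective
    rw [unitFiber.incl_mul, unitFiber.incl_star]
    refine (single_transport _ _).trans ((Cc.single_congr hc).trans ?_)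
    exact (Cc.single_mul_single _ _).symm.trans
      (congrArg (· * Cc.single B 1 c) (Cc.star_single c).symm)
  rw [this]
  exact star_mul_self_nonneg _

theorem inner_self_nonneg (ξ : B.Cc) : 0 ≤ B.inner ξ ξ := by
  rw [inner_eq_sum]
  exact Finset.sum_nonneg fun g _ => starMul_self_nonneg _

theorem inner_self_eq_zero (ξ : B.Cc) : B.inner ξ ξ = 0 ↔ ξ = 0 := by
  refine ⟨fun h => ?_, fun h => by rw [h, inner_zero_left]⟩
  rw [inner_eq_sum, Finset.sum_eq_zero_iff_of_nonneg fun g _ => starMul_self_nonneg _] at h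
  rw [← sum_single_support ξ]
  refine Finset.sum_eq_zero fun g hg => ?_
  have h₁ := (norm_starMul_self _).symm.trans (congrArg norm (h g hg))
  have h₂ : ‖Cc.eval B g ξ‖ ^ 2 = 0 := h₁.trans norm_zero
  rw [norm_eq_zero.mp (pow_eq_zero_iff two_ne_zero |>.mp h₂), map_zero]

variable (B)

/-- Finitely supported sections as a pre-Hilbert module over `B_1`. -/
def PreL2 : Type _ := B.Cc

instance : AddCommGroup B.PreL2 := inferInstanceAs (AddCommGroup B.Cc)
instance : Module ℂ B.PreL2 := inferInstanceAs (Module ℂ B.Cc)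

/-- The norm `‖ξ‖ = ‖⟨ξ, ξ⟩‖ ^ (1/2)`. -/
instance : Norm B.PreL2 := ⟨fun ξ => √‖B.inner ξ ξ‖⟩

/-- The right action of `B_1` on finitely supported sections, `(ξ a) g = (ξ g) a`. -/
instance : SMul (B.unitFiber)ᵐᵒᵖ B.PreL2 :=
  ⟨fun a ξ => (show B.Cc from ξ) * unitFiber.incl B a.unop⟩

instance : CStarModule (B.unitFiber)ᵐᵒᵖ B.PreL2 where
  inner ξ η := MulOpposite.op (B.inner ξ η)
  inner_add_right {ξ η η'} := congrArg MulOpposite.op (inner_add_right ξ η η')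
  inner_self_nonneg {ξ} := inner_self_nonneg ξ
  inner_self {ξ} := (MulOpposite.op_eq_zero_iff _).trans (inner_self_eq_zero ξ)
  inner_op_smul_right {a ξ η} := congrArg MulOpposite.op (inner_mul_incl ξ η a.unop)
  inner_smul_right_complex {c ξ η} := congrArg MulOpposite.op (inner_smul_right c ξ η)
  star_inner ξ η := congrArg MulOpposite.op (star_inner ξ η)
  norm_eq_sqrt_norm_inner_self _ := rfl

theorem preL2Core : NormedSpace.Core ℂ B.PreL2 :=
  CStarModule.normedSpaceCore (B.unitFiber)ᵐᵒᵖ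

instance : NormedAddCommGroup B.PreL2 := NormedAddCommGroup.ofCore B.preL2Core
instance : NormedSpace ℂ B.PreL2 := NormedSpace.ofCore B.preL2Core

theorem norm_preL2 (ξ : B.PreL2) : ‖ξ‖ = √‖B.inner ξ ξ‖ := rfl

theorem norm_sq_preL2 (ξ : B.PreL2) : ‖ξ‖ ^ 2 = ‖B.inner ξ ξ‖ := Real.sq_sqrt (norm_nonneg _)

variable {B}

/-- For `a ≥ 0` in `B_1` and `r ≥ ‖a‖`, `r > 0`, there is a self-adjoint `c` with
`(1 + c) ^ 2 = 1 - a / r`. -/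
theorem exists_sqrt_one_sub (a : B.unitFiber) (ha : 0 ≤ a) (r : ℝ) (hr : 0 < r) (har : ‖a‖ ≤ r) :
    ∃ c : B.unitFiber, star c = c ∧ c + c + c * c = -((r⁻¹ : ℝ) • a) := by
  have hsa : IsSelfAdjoint a := .of_nonneg ha
  let f : ℝ → ℝ := fun t => √(1 - r⁻¹ * t) - 1
  have hf : Continuous f := by fun_prop
  have hf0 : f 0 = 0 := by simp [f]
  refine ⟨cfcₙ f a, (cfcₙ_predicate f a : IsSelfAdjoint _).star_eq, ?_⟩
  rw [← cfcₙ_add (a := a) f f hf.continuousOn hf0 hf.continuousOn hf0,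
    ← cfcₙ_mul f f a hf.continuousOn hf0 hf.continuousOn hf0,
    ← cfcₙ_add (a := a) (fun x => f x + f x) (fun x => f x * f x) (by fun_prop) (by simp [hf0])
      (by fun_prop) (by simp [hf0])]
  have h1 : cfcₙ (fun x : ℝ => -(r⁻¹ * x)) a = -((r⁻¹ : ℝ) • a) := by
    rw [cfcₙ_neg, cfcₙ_const_mul_id r⁻¹ a]
  rw [← h1]
  refine cfcₙ_congr fun t ht => ?_
  have ht' : t ≤ r := by
    refine (le_abs_self t).trans (le_trans ?_ har)
    exact NonUnitalIsometricContinuousFunctionalCalculus.norm_quasispectrum_le a ht hsa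
  have h2 : 0 ≤ 1 - r⁻¹ * t := by
    have : r⁻¹ * t ≤ 1 := by rw [inv_mul_le_iff₀ hr]; simpa using ht'
    linarith
  have h3 := Real.mul_self_sqrt h2
  simp only [f]
  linear_combination h3

theorem incl_starMul {g : G} (a b : B.fiber g) :
    unitFiber.incl B (starMul a b) = star (Cc.single B g a) * Cc.single B g b :=
  (single_transport _ _).trans <| by rw [← Cc.single_mul_single, ← Cc.star_single]

theorem inner_single_mul_le {g : G} (b : B.fiber g) (hb : 0 < ‖b‖) (ξ : B.Cc) :
    B.inner (Cc.single B g b * ξ) (Cc.single B g b * ξ) ≤ (‖b‖ ^ 2) • B.inner ξ ξ := by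
  have hr : 0 < ‖b‖ ^ 2 := by positivity
  obtain ⟨c, hc, hc'⟩ := exists_sqrt_one_sub (starMul b b) (starMul_self_nonneg b) (‖b‖ ^ 2) hr
    (norm_starMul_self b).le
  have h0 := inner_self_nonneg (ξ + unitFiber.incl B c * ξ)
  have hstar : star (unitFiber.incl B c) = unitFiber.incl B c := by
    rw [← unitFiber.incl_star, hc]
  have h1 : B.inner (ξ + unitFiber.incl B c * ξ) (ξ + unitFiber.incl B c * ξ) =
      B.inner ξ ξ + B.inner ξ (unitFiber.incl B (c + c + c * c) * ξ) := by
    rw [map_add, map_add, add_mul, add_mul, unitFiber.incl_mul, mul_assoc]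
    simp only [inner_add_left, inner_add_right]
    rw [inner_mul_left (unitFiber.incl B c) ξ (unitFiber.incl B c * ξ),
      inner_mul_left (unitFiber.incl B c) ξ ξ, hstar]
    abel
  have h2 : B.inner ξ (unitFiber.incl B (c + c + c * c) * ξ) =
      -(((‖b‖ ^ 2)⁻¹ : ℝ) • B.inner (Cc.single B g b * ξ) (Cc.single B g b * ξ)) := by
    have h3 : unitFiber.incl B (c + c + c * c) * ξ = (-((((‖b‖ ^ 2)⁻¹ : ℝ) : ℂ))) •
        (star (Cc.single B g b) * (Cc.single B g b * ξ)) := by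
      rw [hc', ← Complex.coe_smul, ← neg_smul, map_smul, incl_starMul, smul_mul_assoc, mul_assoc]
    rw [h3, inner_smul_right, inner_mul_left (star _), star_star, neg_smul, Complex.coe_smul]
  rw [h1, h2, ← sub_eq_add_neg, sub_nonneg] at h0
  have h4 := smul_le_smul_of_nonneg_left h0 hr.le
  rwa [smul_smul, mul_inv_cancel₀ hr.ne', one_smul] at h4

theorem norm_single_mul_le {g : G} (b : B.fiber g) (ξ : B.PreL2) :
    ‖(show B.PreL2 from Cc.single B g b * (show B.Cc from ξ))‖ ≤ ‖b‖ * ‖ξ‖ := by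
  rcases (norm_nonneg b).eq_or_lt with hb | hb
  · rw [norm_eq_zero.mp hb.symm, norm_zero, map_zero, zero_mul, zero_mul]
    exact (norm_zero (E := B.PreL2)).le
  · refine le_of_sq_le_sq ?_ (by positivity)
    have h := CStarAlgebra.norm_le_norm_of_nonneg_of_le (inner_self_nonneg _)
      (inner_single_mul_le b hb ξ)
    rw [norm_smul, Real.norm_of_nonneg (sq_nonneg _)] at h
    rw [mul_pow, norm_sq_preL2, norm_sq_preL2]
    exact h

theorem exists_norm_mul_le (f : B.Cc) : ∃ C, ∀ ξ : B.PreL2,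
    ‖(show B.PreL2 from f * (show B.Cc from ξ))‖ ≤ C * ‖ξ‖ := by
  induction f using Cc.induction with
  | h₀ =>
    refine ⟨0, fun ξ => ?_⟩
    rw [zero_mul, zero_mul]
    exact (norm_zero (E := B.PreL2)).le
  | h₁ g a => exact ⟨‖a‖, fun ξ => norm_single_mul_le a ξ⟩
  | h₂ f f' hf hf' =>
    obtain ⟨C, hC⟩ := hf
    obtain ⟨C', hC'⟩ := hf'
    refine ⟨C + C', fun ξ => ?_⟩
    rw [add_mul, add_mul]
    exact (norm_add_le (E := B.PreL2) _ _).trans (add_le_add (hC ξ) (hC' ξ))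

/-- Left convolution by `f`, as a bounded operator on finitely supported sections. -/
def preRegular (f : B.Cc) : B.PreL2 →L[ℂ] B.PreL2 :=
  LinearMap.mkContinuousOfExistsBound (Cc.mulₗ B f : B.PreL2 →ₗ[ℂ] B.PreL2) (exists_norm_mul_le f)

theorem preRegular_apply (f : B.Cc) (ξ : B.PreL2) :
    preRegular f ξ = (show B.PreL2 from f * (show B.Cc from ξ)) := rfl

variable (B)

/-- The Hilbert `B_1`-module `ℓ²(B)`. -/
abbrev L2 : Type _ := UniformSpace.Completion B.PreL2

variable {B}

/-- The left regular representation of finitely supported sections on `ℓ²(B)`. -/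
def regular (f : B.Cc) : B.L2 →L[ℂ] B.L2 :=
  ((UniformSpace.Completion.toComplL : B.PreL2 →L[ℂ] B.L2) ∘L preRegular f).extend
    UniformSpace.Completion.toComplL

theorem regular_coe (f : B.Cc) (ξ : B.PreL2) : regular f (ξ : B.L2) = preRegular f ξ :=
  ContinuousLinearMap.extend_eq _ UniformSpace.Completion.denseRange_coe
    (UniformSpace.Completion.isUniformInducing_coe _) ξ

theorem norm_regular (f : B.Cc) : ‖regular f‖ = ‖preRegular f‖ := by
  refine le_antisymm ((regular f).opNorm_le_bound (norm_nonneg _) fun x => ?_)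
    ((preRegular f).opNorm_le_bound (norm_nonneg _) fun ξ => ?_)
  · refine UniformSpace.Completion.induction_on x
      (isClosed_le (regular f).continuous.norm (continuous_const.mul continuous_norm)) fun ξ => ?_
    rw [regular_coe, UniformSpace.Completion.norm_coe, UniformSpace.Completion.norm_coe]
    exact (preRegular f).le_opNorm ξ
  · have := (regular f).le_opNorm (ξ : B.L2)
    rwa [regular_coe, UniformSpace.Completion.norm_coe, UniformSpace.Completion.norm_coe] at this

theorem norm_inner_le (ξ η : B.PreL2) : ‖B.inner ξ η‖ ≤ ‖ξ‖ * ‖η‖ :=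
  CStarModule.norm_inner_le (A := (B.unitFiber)ᵐᵒᵖ) B.PreL2 (x := ξ) (y := η)

theorem preRegular_add (f f' : B.Cc) : preRegular (f + f') = preRegular f + preRegular f' := by
  ext ξ; exact add_mul (R := B.Cc) f f' ξ

theorem preRegular_smul (c : ℂ) (f : B.Cc) : preRegular (c • f) = c • preRegular f := by
  ext ξ; exact smul_mul_assoc (β := B.Cc) c f ξ

theorem preRegular_mul (f f' : B.Cc) : preRegular (f * f') = preRegular f ∘L preRegular f' := by
  ext ξ; exact mul_assoc (G := B.Cc) f f' ξ

theorem norm_preRegular_sq_le (f : B.Cc) : ‖preRegular f‖ ^ 2 ≤ ‖preRegular (star f * f)‖ := by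
  have h : ‖preRegular f‖ ≤ √‖preRegular (star f * f)‖ := by
    refine (preRegular f).opNorm_le_bound (Real.sqrt_nonneg _) fun ξ => ?_
    refine le_of_sq_le_sq ?_ (by positivity)
    rw [mul_pow, Real.sq_sqrt (norm_nonneg _)]
    calc ‖preRegular f ξ‖ ^ 2 = ‖B.inner (preRegular f ξ) (preRegular f ξ)‖ := norm_sq_preL2 B _
      _ = ‖B.inner (preRegular (star f * f) ξ) ξ‖ := by
        congr 1
        exact (inner_mul_left f (f * (show B.Cc from ξ)) ξ).trans
          (congrArg (fun x => B.inner x ξ) (mul_assoc (G := B.Cc) (star f) f ξ).symm)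
      _ ≤ ‖preRegular (star f * f) ξ‖ * ‖ξ‖ := norm_inner_le _ _
      _ ≤ ‖preRegular (star f * f)‖ * ‖ξ‖ * ‖ξ‖ := by
        gcongr; exact ContinuousLinearMap.le_opNorm _ _
      _ = _ := by ring
  exact (pow_le_pow_left₀ (norm_nonneg _) h 2).trans (Real.sq_sqrt (norm_nonneg _)).le

theorem norm_preRegular_le_star (f : B.Cc) : ‖preRegular f‖ ≤ ‖preRegular (star f)‖ := by
  have h := norm_preRegular_sq_le f
  rw [preRegular_mul] at h
  have h' := h.trans (ContinuousLinearMap.opNorm_comp_le _ _)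
  rcases (norm_nonneg (preRegular f)).eq_or_lt with h0 | h0
  · rw [← h0]; exact norm_nonneg _
  · rw [sq] at h'
    exact le_of_mul_le_mul_right h' h0

theorem norm_preRegular_star (f : B.Cc) : ‖preRegular (star f)‖ = ‖preRegular f‖ :=
  le_antisymm ((norm_preRegular_le_star (star f)).trans_eq (by rw [star_star]))
    (norm_preRegular_le_star f)

variable (B)

/-- The reduced C*-seminorm: the operator norm in the left regular representation on `ℓ²(B)`. -/
def reducedSeminorm : CStarSeminorm B.Cc where
  toFun f := ‖regular f‖
  map_zero' := by
    rw [norm_regular]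
    have : preRegular (0 : B.Cc) = 0 := by
      simpa using preRegular_smul 0 (0 : B.Cc)
    rw [this, norm_zero]
  add_le' f f' := by
    simp only [norm_regular, preRegular_add]; exact norm_add_le _ _
  neg' f := by
    have : preRegular (-f) = -preRegular f := by
      simpa using preRegular_smul (-1) f
    simp only [norm_regular, this, norm_neg]
  smul' c f := by simp only [norm_regular, preRegular_smul, norm_smul]
  mul_le' f f' := by
    simp only [norm_regular, preRegular_mul]; exact ContinuousLinearMap.opNorm_comp_le _ _
  map_star' f := by simp only [norm_regular, norm_preRegular_star]
  map_star_mul_self' f := by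
    simp only [norm_regular]
    refine le_antisymm ?_ ((sq _).symm.trans_le (norm_preRegular_sq_le f))
    rw [preRegular_mul]
    exact (ContinuousLinearMap.opNorm_comp_le _ _).trans_eq (by rw [norm_preRegular_star])

/-- The reduced cross-sectional C*-algebra `C*_r(B)`: the completion of the image of the finitely
supported sections under the left regular representation. -/
abbrev ReducedCStar : Type _ := B.reducedSeminorm.Completion

/-- The canonical map `B_g → C*_r(B)`. -/
def toReduced (g : G) : B.fiber g →ₗ[ℂ] B.ReducedCStar :=
  B.reducedSeminorm.toCompletion ∘ₗ Cc.single B g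

end Reduced

/-- A representation of a Fell bundle in a C*-algebra `A`. -/
structure Rep (A : Type*) [NonUnitalCStarAlgebra A] where
  map : ∀ g, B.fiber g →ₗ[ℂ] A
  map_mul : ∀ {g h : G} (a : B.fiber g) (b : B.fiber h), map (g * h) (B.fmul a b) = map g a * map h b
  map_star : ∀ {g : G} (a : B.fiber g), map g⁻¹ (B.fstar a) = star (map g a)

/-- A representation is faithful if it is injective on the unit fibre. -/
def Rep.IsFaithful {B : FellBundle G} {A : Type*} [NonUnitalCStarAlgebra A] (π : B.Rep A) : Prop :=
  Function.Injective (π.map 1)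

end FellBundle

/-- A completely positive map between C*-algebras as a bounded linear operator; its norm is the
usual operator norm. Positive maps between C*-algebras are automatically bounded. -/
def CompletelyPositiveMap.toCLM {A₁ A₂ : Type*} [NonUnitalCStarAlgebra A₁]
    [NonUnitalCStarAlgebra A₂] [PartialOrder A₁] [PartialOrder A₂] [StarOrderedRing A₁]
    [StarOrderedRing A₂] (φ : CompletelyPositiveMap A₁ A₂) : A₁ →L[ℂ] A₂ :=
  ⟨(φ : A₁ →ₗ[ℂ] A₂), map_continuous φ⟩

end

/-!
Let `ψ g : B_g → C_g` be the linear maps with `π_g ∘ ψ g = φ` on `B_g`; they exist because a faithful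
representation is isometric on every fibre. Together they give a linear map `sectionMap ψ` of the
finitely supported sections, and `φ'` is its continuous extension to the reduced completions.

Everything rests on one positivity statement, `sum_coefficient_sectionMap_nonneg`: for sections
`n i` of `B` and `ξ i` of `C` and a vector `h`,
`0 ≤ ∑ i j, ⟨h, π(⟨ξ i, ψ((n i)⋆ * n j) * ξ j⟩) h⟩`. Expanded into the values of the sections, this is
a sum of terms `⟨π(c) h, φ(a⋆ b) π(d) h⟩`, with `a` at `u`, `c` at `s`, `b` at `v` and `d` at `t`, over
all `u s = v t`. It splits into one block for each value of `u s`, and each block is nonnegative by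
the complete positivity of `φ`. No dilation of `φ` and no absorption principle is needed.

Boundedness (`reducedSeminorm_sectionMap_le`): each functional `f ↦ ⟨h, π(⟨η, ψ(f) * ξ⟩) h⟩` depends on
finitely many values of `f`, and so extends continuously to `C*_r(B)`, because the values of a section
are bounded by its reduced norm (`norm_eval_le_reducedSeminorm`). For two vectors `η`, `ξ` these
functionals form a positive `2 × 2` matrix. The Cauchy–Schwarz inequality and an approximate unit then
bound the off-diagonal entry by the values of the diagonal entries on the approximate unit
(`norm_sq_le_of_kernel_nonneg_of_tendsto`). The approximate unit is taken in `B_1`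
(`tendsto_incl_mul`), and there the diagonal entries are at most `‖φ‖ ⟨h, π(⟨ξ, ξ⟩) h⟩`. The choice
`η = ψ(f) * ξ` gives `‖ψ(f)‖ ≤ ‖φ‖ ‖f‖` for the reduced norms.

Complete positivity: the same functionals with `η = ξ` extend to a separating family of positive
functionals on `C*_r(C)`, and such families detect positivity of self-adjoint matrices
(`CStarMatrix.nonneg_of_forall_sum_nonneg`).

Norm equality: since `B_1` contains an approximate unit of `C*(B)`, the estimate for `2 × 2` matrices
of functionals, applied to `⟨k, φ(·) h⟩`, shows that `‖φ‖` is the norm of `φ` on `B_1`, where `φ` and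
`φ'` are isometric images of `ψ 1`.
-/

noncomputable section

open scoped ComplexOrder Topology InnerProductSpace
open Filter

/-! ### Positivity in C⋆-algebras and matrices over them -/

theorem CStarAlgebra.exists_eq_star_mul_self_of_nonneg {E : Type*} [NonUnitalCStarAlgebra E]
    [PartialOrder E] [StarOrderedRing E] {x : E} (hx : 0 ≤ x) : ∃ y, x = star y * y :=
  CStarAlgebra.nonneg_iff_eq_star_mul_self.mp hx

/-- If a self-adjoint element `Y` of a C⋆-algebra is not positive, this is witnessed by compressing
`Y` to its negative part `N`: then `N Y N = -N³` is a nonzero negative element. -/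
theorem IsSelfAdjoint.exists_conjugate_eq_neg_star_mul_self {E : Type*} [NonUnitalCStarAlgebra E]
    [PartialOrder E] [StarOrderedRing E] {Y : E} (hY : IsSelfAdjoint Y) :
    ∃ N W : E, star N = N ∧ N * Y * N = -(star W * W) ∧ (W = 0 → 0 ≤ Y) := by
  set N := Y⁻ with hN
  have hN0 : 0 ≤ N := CFC.negPart_nonneg Y
  have hNs : star N = N := (IsSelfAdjoint.of_nonneg hN0).star_eq
  have hNYN : N * Y * N = -(N * N * N) := by
    conv_lhs => rw [← CFC.posPart_sub_negPart Y hY, mul_sub, CFC.negPart_mul_posPart, zero_sub,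
      ← hN, neg_mul]
  obtain ⟨W, hW⟩ : ∃ W, N * N * N = star W * W := by
    have h3 : 0 ≤ star N * N * N := star_left_conjugate_nonneg hN0 N
    rw [hNs] at h3
    exact CStarAlgebra.exists_eq_star_mul_self_of_nonneg h3
  refine ⟨N, W, hNs, hNYN.trans (congrArg _ hW), fun hW0 => ?_⟩
  have hNNN : N * N * N = 0 := by rw [hW, hW0, mul_zero]
  have hNN : N * N = 0 := by
    refine CStarRing.star_mul_self_eq_zero_iff _ |>.mp ?_
    rw [star_mul, hNs, ← mul_assoc, hNNN, zero_mul]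
  have hN1 : N = 0 := by
    refine CStarRing.star_mul_self_eq_zero_iff _ |>.mp ?_
    rw [hNs, hNN]
  exact (CFC.negPart_eq_zero_iff Y hY).mp hN1

/-- A self-adjoint matrix over a C⋆-algebra is positive as soon as the sums
`∑ j k, θ (ξ j)⋆ (Y j k) (ξ k)` are nonnegative for a separating family of positive functionals `θ`
and all columns `ξ`: on the columns of the negative part of `Y` these sums are nonpositive. -/
theorem CStarMatrix.nonneg_of_forall_sum_nonneg {n D ι : Type*} [Fintype n]
    [NonUnitalCStarAlgebra D] [PartialOrder D] [StarOrderedRing D] (θ : ι → D →ₗ[ℂ] ℂ)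
    (hθ : ∀ i a, 0 ≤ θ i (star a * a)) (hsep : ∀ a, (∀ i, θ i (star a * a) = 0) → a = 0)
    (Y : CStarMatrix n n D) (hY : IsSelfAdjoint Y)
    (h : ∀ i (ξ : n → D), 0 ≤ ∑ j, ∑ k, θ i (star (ξ j) * Y j k * ξ k)) : 0 ≤ Y := by
  obtain ⟨N, W, hNs, hNYN, hWY⟩ := hY.exists_conjugate_eq_neg_star_mul_self
  refine hWY ?_
  ext m l
  refine hsep _ fun i => ?_
  have h1 := h i fun j => N j l
  have h2 : ∑ j, ∑ k, θ i (star (N j l) * Y j k * N k l) =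
      -∑ m, θ i (star (W m l) * W m l) := by
    rw [← map_sum, ← map_neg]
    have : ∑ m, star (W m l) * W m l = (star W * W) l l := by
      rw [CStarMatrix.mul_apply]; rfl
    rw [this, ← CStarMatrix.neg_apply, ← hNYN, CStarMatrix.mul_apply]
    simp_rw [CStarMatrix.mul_apply, Finset.sum_mul, map_sum]
    rw [Finset.sum_comm]
    refine Finset.sum_congr rfl fun k _ => Finset.sum_congr rfl fun j _ => ?_
    conv_rhs => rw [← hNs]
    rw [CStarMatrix.star_apply, hNs]
  rw [h2, Left.nonneg_neg_iff] at h1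
  have h3 := le_antisymm h1 (Finset.sum_nonneg fun m _ => hθ i (W m l))
  exact (Finset.sum_eq_zero_iff_of_nonneg fun m _ => hθ i (W m l)).mp h3 m (Finset.mem_univ m)

theorem CStarMatrix.exists_eq_sum_star_mul {n D : Type*} [Fintype n] [NonUnitalCStarAlgebra D]
    [PartialOrder D] [StarOrderedRing D] {M : CStarMatrix n n D} (hM : 0 ≤ M) :
    ∃ L : CStarMatrix n n D, ∀ x y, M x y = ∑ z, star (L z x) * L z y := by
  obtain ⟨L, rfl⟩ := CStarAlgebra.exists_eq_star_mul_self_of_nonneg hM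
  exact ⟨L, fun x y => CStarMatrix.mul_apply⟩

/-! ### Positive matrices of functionals and approximate units -/

section Kernel

variable {A : Type*} [NonUnitalCStarAlgebra A]

/-- The Cauchy–Schwarz inequality for a positive `2 × 2` matrix of functionals. -/
theorem norm_sq_le_of_kernel_nonneg (ω : Fin 2 → Fin 2 → A →L[ℂ] ℂ)
    (hω : ∀ x : Fin 2 → A, 0 ≤ ∑ a, ∑ b, ω a b (star (x a) * x b)) (x y : A) :
    ‖ω 0 1 (star x * y)‖ ^ 2 ≤ (ω 0 0 (star x * x)).re * (ω 1 1 (star y * y)).re := by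
  let M : Matrix (Fin 2) (Fin 2) ℂ := fun a b => ω a b (star (![x, y] a) * ![x, y] b)
  have hq : ∀ c : Fin 2 → ℂ, 0 ≤ dotProduct (star c) (M.mulVec c) := by
    intro c
    have := hω fun a => c a • ![x, y] a
    convert this using 1
    simp only [dotProduct, Matrix.mulVec, Finset.mul_sum, star_smul, smul_mul_assoc,
      mul_smul_comm, map_smul, smul_eq_mul, M, Pi.star_apply]
    refine Finset.sum_congr rfl fun a _ => Finset.sum_congr rfl fun b _ => by ring
  have hM : M.PosSemidef := by
    refine Matrix.posSemidef_iff_dotProduct_mulVec.mpr ⟨?_, hq⟩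
    -- polarization: the quadratic form of `M` is real
    have q₀ := (Complex.le_def.mp (hq ![1, 0])).2
    have q₁ := (Complex.le_def.mp (hq ![0, 1])).2
    have q₂ := (Complex.le_def.mp (hq ![1, 1])).2
    have q₃ := (Complex.le_def.mp (hq ![1, Complex.I])).2
    simp [dotProduct, Matrix.mulVec, Fin.sum_univ_two] at q₀ q₁ q₂ q₃
    ext a b
    fin_cases a <;> fin_cases b <;> apply Complex.ext <;> simp <;> linarith
  have h0 : 0 ≤ M 0 0 := hM.diag_nonneg
  have h1 : 0 ≤ M 1 1 := hM.diag_nonneg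
  have hd := hM.det_nonneg
  have h10 : M 1 0 = star (M 0 1) := (hM.isHermitian.apply 1 0).symm
  rw [Matrix.det_fin_two, h10] at hd
  have hd' := (Complex.le_def.mp hd).1
  have e0 : (M 0 0).im = 0 := (Complex.le_def.mp h0).2.symm
  have e2 : ‖M 0 1‖ ^ 2 = (M 0 1).re * (M 0 1).re + (M 0 1).im * (M 0 1).im := by
    rw [Complex.sq_norm, Complex.normSq_apply]
  change ‖M 0 1‖ ^ 2 ≤ (M 0 0).re * (M 1 1).re
  rw [e2]
  simp [e0] at hd'
  linarith

variable [PartialOrder A] [StarOrderedRing A]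

theorem apply_nonneg_of_kernel_nonneg (ω : Fin 2 → Fin 2 → A →L[ℂ] ℂ)
    (hω : ∀ x : Fin 2 → A, 0 ≤ ∑ a, ∑ b, ω a b (star (x a) * x b)) (a : Fin 2) {x : A}
    (hx : 0 ≤ x) : 0 ≤ ω a a x := by
  obtain ⟨y, rfl⟩ := CStarAlgebra.exists_eq_star_mul_self_of_nonneg hx
  have h := hω (Pi.single a y)
  fin_cases a <;> simpa [Pi.single_apply] using h

/-- The off-diagonal entry of a positive `2 × 2` matrix of functionals is bounded in terms of the
values of the diagonal entries on an approximate unit: `ω 0 1 (e f)` is estimated by the Cauchy–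
Schwarz inequality, and `ω 1 1 (f⋆ f)` is the limit of `ω 1 1 (e f⋆ f e) ≤ ‖f‖² ω 1 1 (e e)`. -/
theorem norm_sq_le_of_kernel_nonneg_of_tendsto {ι : Type*} {l : Filter ι} [l.NeBot] (e : ι → A)
    (he : ∀ x, Tendsto (fun i => e i * x) l (𝓝 x)) (hs : ∀ᶠ i in l, star (e i) = e i)
    (hn : ∀ᶠ i in l, ‖e i‖ ≤ 1) (ω : Fin 2 → Fin 2 → A →L[ℂ] ℂ)
    (hω : ∀ x : Fin 2 → A, 0 ≤ ∑ a, ∑ b, ω a b (star (x a) * x b)) {M₀ M₁ : ℝ}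
    (hM₀ : ∀ᶠ i in l, (ω 0 0 (e i * e i)).re ≤ M₀) (hM₁ : ∀ᶠ i in l, (ω 1 1 (e i * e i)).re ≤ M₁)
    (f : A) : ‖ω 0 1 f‖ ^ 2 ≤ M₀ * (M₁ * ‖f‖ ^ 2) := by
  set y := star f * f
  have hy : star y = y := by simp [y]
  have hye : Tendsto (fun i => y * e i) l (𝓝 y) := by
    have := (continuous_star.tendsto y).comp (he y)
    rw [hy] at this
    refine this.congr' (hs.mono fun i hi => ?_)
    simp [hi, hy]
  have heye : Tendsto (fun i => e i * y * e i) l (𝓝 y) := by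
    have h1 : Tendsto (fun i => e i * (y * e i - y)) l (𝓝 0) := by
      refine squeeze_zero_norm' (a := fun i => ‖y * e i - y‖) (hn.mono fun i hi => ?_) ?_
      · exact (norm_mul_le _ _).trans (mul_le_of_le_one_left (norm_nonneg _) hi)
      · simpa using (hye.sub_const y).norm
    have := h1.add (he y)
    rw [zero_add] at this
    refine this.congr fun i => ?_
    rw [mul_sub, ← mul_assoc (e i) y, sub_add_cancel]
  have h1 : (ω 1 1 y).re ≤ M₁ * ‖f‖ ^ 2 := by
    have ht := (Complex.continuous_re.tendsto _).comp (((ω 1 1).continuous.tendsto y).comp heye)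
    refine le_of_tendsto ht ?_
    filter_upwards [hs, hM₁] with i hi hMi
    have hle : e i * y * e i ≤ ‖y‖ • (e i * e i) := by
      have := CStarAlgebra.star_left_conjugate_le_norm_smul (a := e i) (b := y) hy
      rwa [hi] at this
    have h2 := apply_nonneg_of_kernel_nonneg ω hω 1 (sub_nonneg.mpr hle)
    rw [map_sub, ← Complex.coe_smul, map_smul] at h2
    have h3 := (Complex.le_def.mp h2).1
    have h4 : ‖y‖ = ‖f‖ ^ 2 := by rw [sq]; exact CStarRing.norm_star_mul_self
    simp only [Complex.zero_re, Complex.sub_re, smul_eq_mul, Complex.re_ofReal_mul, h4] at h3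
    change (ω 1 1 (e i * y * e i)).re ≤ _
    nlinarith [mul_le_mul_of_nonneg_left hMi (sq_nonneg ‖f‖)]
  have hy0 : 0 ≤ (ω 1 1 y).re :=
    (Complex.le_def.mp (apply_nonneg_of_kernel_nonneg ω hω 1 (star_mul_self_nonneg f))).1
  refine le_of_tendsto (((ω 0 1).continuous.tendsto f).comp (he f) |>.norm.pow 2) ?_
  filter_upwards [hs, hM₀] with i hi hMi
  have := norm_sq_le_of_kernel_nonneg ω hω (e i) f
  rw [hi] at this
  have h00 : 0 ≤ (ω 0 0 (e i * e i)).re := by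
    have := (Complex.le_def.mp (apply_nonneg_of_kernel_nonneg ω hω 0 (star_mul_self_nonneg (e i)))).1
    rwa [hi] at this
  exact this.trans (mul_le_mul hMi h1 hy0 (h00.trans hMi))

end Kernel

/-! ### Extension to completions -/

namespace CStarSeminorm

/-- A linear map on a `*`-algebra that is bounded for a C⋆-seminorm extends to the completion. -/
theorem exists_extension {A F : Type*} [NonUnitalRing A] [StarRing A] [Module ℂ A]
    [NormedAddCommGroup F] [NormedSpace ℂ F] [CompleteSpace F] (p : CStarSeminorm A)
    (f : A →ₗ[ℂ] F) {K : ℝ} (hf : ∀ x, ‖f x‖ ≤ K * p.toSeminorm x) :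
    ∃ T : p.Completion →L[ℂ] F, (∀ x, T (p.toCompletion x) = f x) ∧ ∀ y, ‖T y‖ ≤ K * ‖y‖ := by
  let f' : p.Carrier →L[ℂ] F := LinearMap.mkContinuous (show p.Carrier →ₗ[ℂ] F from f) K hf
  let T₀ : UniformSpace.Completion p.Carrier →L[ℂ] F :=
    f'.extend (UniformSpace.Completion.toComplL : p.Carrier →L[ℂ] _)
  let T : p.Completion →L[ℂ] F :=
    { toFun := T₀
      map_add' := T₀.map_add
      map_smul' := T₀.map_smul
      cont := T₀.continuous }
  have hT : ∀ x, T (p.toCompletion x) = f x := fun x =>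
    ContinuousLinearMap.extend_eq f' UniformSpace.Completion.denseRange_coe
      (UniformSpace.Completion.isUniformInducing_coe _) x
  refine ⟨T, hT, fun y => ?_⟩
  refine p.induction_on (P := fun y => ‖T y‖ ≤ K * ‖y‖) y
    (isClosed_le T.continuous.norm (continuous_const.mul continuous_norm)) fun a => ?_
  rw [hT, norm_toCompletion]
  exact hf a

theorem induction_on_pi {A J : Type*} [NonUnitalRing A] [StarRing A] [Module ℂ A]
    (p : CStarSeminorm A) {P : (J → p.Completion) → Prop} (x : J → p.Completion)
    (hP : IsClosed {x | P x}) (h : ∀ a : J → A, P fun j => p.toCompletion (a j)) : P x :=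
  (DenseRange.piMap fun _ : J => p.denseRange_toCompletion).induction_on (p := P) x hP h

/-- Complete positivity of a continuous map on the completion of a `*`-algebra need only be checked
on the matrices `(n i)⋆ (n j)` that come from rows of the `*`-algebra. -/
theorem map_cstarMatrix_nonneg {A D J : Type*} [NonUnitalRing A] [StarRing A]
    [Module ℂ A] [IsScalarTower ℂ A A] [SMulCommClass ℂ A A] [StarModule ℂ A]
    [NonUnitalCStarAlgebra D] [PartialOrder D] [StarOrderedRing D] [Fintype J]
    (p : CStarSeminorm A) (T : p.Completion →L[ℂ] D)
    (hT : ∀ n : J → A, 0 ≤ (CStarMatrix.ofMatrix fun i j => T (p.toCompletion (star (n i) * n j)) :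
      CStarMatrix J J D)) (M : CStarMatrix J J p.Completion) (hM : 0 ≤ M) : 0 ≤ M.map T := by
  obtain ⟨L, hL⟩ := CStarMatrix.exists_eq_sum_star_mul hM
  have hrow : ∀ x : J → p.Completion,
      0 ≤ (CStarMatrix.ofMatrix fun i j => T (star (x i) * x j) : CStarMatrix J J D) := by
    intro x
    refine p.induction_on_pi (P := fun x => 0 ≤ (CStarMatrix.ofMatrix fun i j =>
      T (star (x i) * x j) : CStarMatrix J J D)) x ?_ fun n => ?_
    · refine IsClosed.preimage (f := fun x : J → p.Completion => (CStarMatrix.ofMatrix fun i j =>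
        T (star (x i) * x j) : CStarMatrix J J D)) ?_ CStarAlgebra.isClosed_nonneg
      refine CStarMatrix.ofMatrixL.continuous.comp (continuous_matrix fun i j => ?_)
      fun_prop
    · simpa only [← p.toCompletion_star, ← p.toCompletion_mul] using hT n
  have : M.map T = ∑ z, CStarMatrix.ofMatrix fun i j => T (star (L z i) * L z j) := by
    ext i j
    rw [CStarMatrix.map_apply, hL, map_sum]
    exact (Matrix.sum_apply i j Finset.univ fun z => Matrix.of fun i j =>
      T (star (L z i) * L z j)).symm
  rw [this]
  exact Finset.sum_nonneg fun z _ => hrow _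

end CStarSeminorm

/-! ### Reduced norms and approximate units of Fell bundles -/

namespace FellBundle

variable {G : Type*} [Group G] {B : FellBundle G}

theorem norm_single_preL2 {g : G} (b : B.fiber g) :
    ‖(show B.PreL2 from Cc.single B g b)‖ = ‖b‖ := by
  rw [← sq_eq_sq₀ (norm_nonneg _) (norm_nonneg _), norm_sq_preL2]
  change ‖B.inner (Cc.single B g b) (Cc.single B g b)‖ = _
  rw [inner_single, Cc.eval_single_same, norm_starMul_self]

theorem norm_preRegular_apply_le (f : B.Cc) (ξ : B.PreL2) :
    ‖(show B.PreL2 from f * (show B.Cc from ξ))‖ ≤ B.reducedSeminorm.toSeminorm f * ‖ξ‖ :=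
  ((preRegular f).le_opNorm ξ).trans_eq (by rw [← norm_regular]; rfl)

/-- The coefficients of a section are bounded by its reduced norm: with `b = f g`, compare the two
sides of `⟨b δ_g, f * (b⋆ b δ_1)⟩ = (b⋆ b)²`. -/
theorem norm_eval_le_reducedSeminorm (g : G) (f : B.Cc) :
    ‖Cc.eval B g f‖ ≤ B.reducedSeminorm.toSeminorm f := by
  set b := Cc.eval B g f with hb
  set a : B.unitFiber := starMul b b with ha
  have ha' : star a = a := (IsSelfAdjoint.of_nonneg (starMul_self_nonneg b)).star_eq
  have hna : ‖a‖ = ‖b‖ ^ 2 := norm_starMul_self b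
  have h1 : B.inner (Cc.single B g b) (f * unitFiber.incl B a) = star a * a := by
    rw [inner_mul_incl, inner_single, ← hb, ha']
  have h2 : ‖star a * a‖ = ‖a‖ * ‖a‖ := CStarRing.norm_star_mul_self
  have h3 := norm_inner_le (show B.PreL2 from Cc.single B g b)
    (show B.PreL2 from f * unitFiber.incl B a)
  have h4 := norm_preRegular_apply_le f (show B.PreL2 from unitFiber.incl B a)
  have h5 : ‖(show B.PreL2 from unitFiber.incl B a)‖ = ‖a‖ := norm_single_preL2 (g := 1) a
  rw [norm_single_preL2] at h3
  rw [h5] at h4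
  have h6 : ‖a‖ * ‖a‖ ≤ ‖b‖ * (B.reducedSeminorm.toSeminorm f * ‖a‖) := by
    rw [← h2, ← h1]
    exact h3.trans (mul_le_mul_of_nonneg_left h4 (norm_nonneg b))
  rw [hna] at h6
  rcases (norm_nonneg b).eq_or_lt with h0 | h0
  · rw [← h0]; exact B.reducedSeminorm.nonneg f
  · refine le_of_mul_le_mul_left ?_ (pow_pos h0 3)
    calc ‖b‖ ^ 3 * ‖b‖ = ‖b‖ ^ 2 * ‖b‖ ^ 2 := by ring
      _ ≤ _ := h6
      _ = _ := by ring

section ApproximateUnit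

open CStarAlgebra

theorem eventually_approximateUnit (B : FellBundle G) :
    ∀ᶠ e in approximateUnit B.unitFiber, star e = e ∧ ‖e‖ ≤ 1 :=
  (increasingApproximateUnit B.unitFiber).eventually_star_eq.and
    (increasingApproximateUnit B.unitFiber).eventually_norm

theorem norm_toCompletion_incl_le (p : CStarSeminorm B.Cc) (a : B.unitFiber) :
    ‖p.toCompletion (unitFiber.incl B a)‖ ≤ ‖a‖ :=
  (p.norm_toCompletion _).trans_le (seminorm_incl_le p a)

/-- The approximate unit of the unit fibre acts as an approximate unit on each fibre: with
`x = b δ_g` and `y = x x⋆`, which lies in the unit fibre, `‖e x - x‖² ≤ 2 ‖e y - y‖`. -/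
theorem tendsto_incl_mul_single (p : CStarSeminorm B.Cc) (g : G) (b : B.fiber g) :
    Tendsto (fun e : B.unitFiber => p.toCompletion (unitFiber.incl B e * Cc.single B g b))
      (approximateUnit B.unitFiber) (𝓝 (p.toCompletion (Cc.single B g b))) := by
  set x := p.toCompletion (Cc.single B g b)
  set a : B.unitFiber := starMul (B.fstar b) (B.fstar b)
  have hx : x * star x = p.toCompletion (unitFiber.incl B a) := by
    rw [incl_starMul, ← Cc.star_single, star_star, p.toCompletion_mul, p.toCompletion_star]
  have hlim : Tendsto (fun e : B.unitFiber => ‖e * a - a‖) (approximateUnit B.unitFiber) (𝓝 0) := by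
    have := ((increasingApproximateUnit B.unitFiber).tendsto_mul_right a).sub_const a
    simpa using this.norm
  rw [tendsto_iff_norm_sub_tendsto_zero]
  have hsq : Tendsto (fun e : B.unitFiber => √(2 * ‖e * a - a‖))
      (approximateUnit B.unitFiber) (𝓝 0) := by
    have := (Real.continuous_sqrt.tendsto _).comp (hlim.const_mul 2)
    rwa [mul_zero, Real.sqrt_zero] at this
  refine squeeze_zero' (.of_forall fun e => norm_nonneg _) ?_ hsq
  filter_upwards [eventually_approximateUnit B] with e he
  refine Real.le_sqrt_of_sq_le ?_
  set E := p.toCompletion (unitFiber.incl B e) with hE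
  have hEs : star E = E := by rw [hE, ← p.toCompletion_star, ← unitFiber.incl_star, he.1]
  have hEn : ‖E‖ ≤ 1 := (norm_toCompletion_incl_le p e).trans he.2
  set Z := p.toCompletion (unitFiber.incl B (e * a - a)) with hZ
  have hZ' : Z = E * (x * star x) - x * star x := by
    rw [hZ, map_sub, map_sub, unitFiber.incl_mul, p.toCompletion_mul, hx]
  have hZn : ‖Z‖ ≤ ‖e * a - a‖ := norm_toCompletion_incl_le p _
  rw [p.toCompletion_mul]
  change ‖E * x - x‖ ^ 2 ≤ _
  have h1 : ‖(E * x - x) * star (E * x - x)‖ = ‖E * x - x‖ * ‖E * x - x‖ :=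
    CStarRing.norm_self_mul_star
  have h2 : (E * x - x) * star (E * x - x) = Z * E - Z := by
    rw [hZ', star_sub, star_mul, hEs]
    noncomm_ring
  rw [sq, ← h1, h2]
  calc ‖Z * E - Z‖ ≤ ‖Z‖ * ‖E‖ + ‖Z‖ := (norm_sub_le _ _).trans (by gcongr; exact norm_mul_le _ _)
    _ ≤ ‖Z‖ * 1 + ‖Z‖ := by gcongr
    _ ≤ 2 * ‖e * a - a‖ := by linarith

/-- The approximate unit of the unit fibre is one for every C⋆-completion of the sections. -/
theorem tendsto_incl_mul (p : CStarSeminorm B.Cc) (x : p.Completion) :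
    Tendsto (fun e : B.unitFiber => p.toCompletion (unitFiber.incl B e) * x)
      (approximateUnit B.unitFiber) (𝓝 x) := by
  have hCc : ∀ f : B.Cc, Tendsto
      (fun e : B.unitFiber => p.toCompletion (unitFiber.incl B e) * p.toCompletion f)
      (approximateUnit B.unitFiber) (𝓝 (p.toCompletion f)) := by
    intro f
    simp only [← p.toCompletion_mul]
    induction f using Cc.induction with
    | h₀ => simp only [mul_zero]; exact tendsto_const_nhds
    | h₁ g b => exact tendsto_incl_mul_single p g b
    | h₂ f f' hf hf' =>
      simp only [mul_add, map_add]
      exact hf.add hf'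
  rw [Metric.tendsto_nhds]
  intro ε hε
  obtain ⟨f, hf⟩ := p.denseRange_toCompletion.exists_dist_lt x (ε := ε / 3) (by positivity)
  filter_upwards [eventually_approximateUnit B, Metric.tendsto_nhds.mp (hCc f) (ε / 3)
    (by positivity)] with e he hef
  set E := p.toCompletion (unitFiber.incl B e)
  have hEn : ‖E‖ ≤ 1 := (norm_toCompletion_incl_le p e).trans he.2
  have h1 : dist (E * x) (E * p.toCompletion f) ≤ dist x (p.toCompletion f) := by
    rw [dist_eq_norm, dist_eq_norm, ← mul_sub]
    exact (norm_mul_le _ _).trans (mul_le_of_le_one_left (norm_nonneg _) hEn)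
  have h2 := dist_triangle4 (E * x) (E * p.toCompletion f) (p.toCompletion f) x
  rw [dist_comm (p.toCompletion f) x] at h2
  linarith

end ApproximateUnit

/-! ### Representations of Fell bundles -/

namespace Rep

variable {A : Type*} [NonUnitalCStarAlgebra A] (π : B.Rep A)

theorem map_transport {g h : G} (e : g = h) (a : B.fiber g) :
    π.map h (transport e a) = π.map g a := by subst e; rfl

/-- A representation of a Fell bundle restricts to a `*`-homomorphism on the unit fibre. -/
def unitHom : B.unitFiber →⋆ₙₐ[ℂ] A where
  toFun a := π.map 1 a
  map_smul' c a := map_smul (π.map 1) c a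
  map_zero' := map_zero (π.map 1)
  map_add' a b := map_add (π.map 1) a b
  map_mul' a b := (π.map_transport (mul_one 1) _).trans (π.map_mul (g := 1) (h := 1) a b)
  map_star' a := (π.map_transport inv_one _).trans (π.map_star (g := 1) a)

theorem unitHom_apply (a : B.unitFiber) : π.unitHom a = π.map 1 a := rfl

theorem unitHom_evalUnit_single (g : G) (a : B.fiber g) [Decidable (g = 1)] :
    π.unitHom (B.evalUnit (Cc.single B g a)) = if g = 1 then π.map g a else 0 := by
  split_ifs with hg
  · rw [evalUnit_single hg]; exact π.map_transport hg a
  · rw [evalUnit_single_ne hg, map_zero]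

theorem unitHom_starMul {g : G} (a b : B.fiber g) :
    π.unitHom (starMul a b) = star (π.map g a) * π.map g b := by
  rw [unitHom_apply, starMul, map_transport, π.map_mul, π.map_star]

variable {π}

theorem IsFaithful.norm_unitHom (hπ : π.IsFaithful) (a : B.unitFiber) : ‖π.unitHom a‖ = ‖a‖ :=
  NonUnitalStarAlgHom.norm_map (A := B.unitFiber) π.unitHom hπ a

theorem IsFaithful.norm_map (hπ : π.IsFaithful) {g : G} (a : B.fiber g) : ‖π.map g a‖ = ‖a‖ := by
  rw [← sq_eq_sq₀ (norm_nonneg _) (norm_nonneg _), ← norm_starMul_self, ← hπ.norm_unitHom,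
    unitHom_starMul, sq]
  exact CStarRing.norm_star_mul_self.symm

theorem IsFaithful.injective (hπ : π.IsFaithful) (g : G) : Function.Injective (π.map g) :=
  (injective_iff_map_eq_zero _).mpr fun a ha => by
    rw [← norm_eq_zero, ← hπ.norm_map, ha, norm_zero]

end Rep

end FellBundle

/-! ### Kernels of completely positive maps -/

variable {H : Type*} [NormedAddCommGroup H] [InnerProductSpace ℂ H] [CompleteSpace H]

/-- The kernel `(a, h), (b, k) ↦ ⟨h, φ(a⋆ b) k⟩` of a completely positive map `φ` is positive. -/
theorem CompletelyPositiveMap.sum_inner_nonneg {A J : Type*} [NonUnitalCStarAlgebra A]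
    [PartialOrder A] [StarOrderedRing A] (φ : CompletelyPositiveMap A (H →L[ℂ] H)) [Fintype J]
    (a : J → A) (k : J → H) : 0 ≤ ∑ x, ∑ y, ⟪k x, φ (star (a x) * a y) (k y)⟫_ℂ := by
  classical
  rcases isEmpty_or_nonempty J with hJ | ⟨⟨o⟩⟩
  · simp
  -- the matrix `(a x)⋆ (a y)` is `N⋆ N`, where the only nonzero row of `N` is `a`
  let N : CStarMatrix J J A := CStarMatrix.ofMatrix fun z y => if z = o then a y else 0
  have hN : ∀ x y, (star N * N) x y = star (a x) * a y := by
    intro x y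
    rw [CStarMatrix.mul_apply]
    have : ∀ z, star N x z * N z y = if z = o then star (a x) * a y else 0 := by
      intro z
      rw [CStarMatrix.star_apply]
      change star (if z = o then a x else 0) * (if z = o then a y else 0) = _
      split_ifs <;> simp
    simp [this]
  obtain ⟨L, hL⟩ := CStarMatrix.exists_eq_sum_star_mul
    (φ.map_cstarMatrix_nonneg (star N * N) (star_mul_self_nonneg N))
  have hφ : ∀ x y, φ (star (a x) * a y) = ∑ z, star (L z x) * L z y := fun x y => by
    rw [← hL, CStarMatrix.map_apply, hN]
  have : ∑ x, ∑ y, ⟪k x, φ (star (a x) * a y) (k y)⟫_ℂ =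
      ∑ z, ⟪∑ x, L z x (k x), ∑ y, L z y (k y)⟫_ℂ := by
    have h1 : ∀ x y, ⟪k x, φ (star (a x) * a y) (k y)⟫_ℂ =
        ∑ z, ⟪L z x (k x), L z y (k y)⟫_ℂ := by
      intro x y
      rw [hφ, sum_apply, inner_sum]
      refine Finset.sum_congr rfl fun z _ => ?_
      rw [mul_apply_eq_comp, ContinuousLinearMap.star_eq_adjoint,
        ContinuousLinearMap.adjoint_inner_right]
    simp_rw [h1, sum_inner, inner_sum]
    symm
    rw [Finset.sum_comm]
    exact Finset.sum_congr rfl fun x _ => Finset.sum_comm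
  rw [this]
  exact Finset.sum_nonneg fun z _ => by
    rw [inner_self_eq_norm_sq_to_K]; positivity

/-- A variant of `CompletelyPositiveMap.sum_inner_nonneg` for sums that are block diagonal with
respect to a labelling `r` of the indices. -/
theorem CompletelyPositiveMap.sum_ite_inner_nonneg {A J G : Type*} [NonUnitalCStarAlgebra A]
    [PartialOrder A] [StarOrderedRing A] (φ : CompletelyPositiveMap A (H →L[ℂ] H)) (P : Finset J)
    (r : J → G) [DecidableEq G] (a : J → A) (k : J → H) :
    0 ≤ ∑ x ∈ P, ∑ y ∈ P, if r x = r y then ⟪k x, φ (star (a x) * a y) (k y)⟫_ℂ else 0 := by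
  have h1 : ∀ x ∈ P, ∀ y, (if r x = r y then ⟪k x, φ (star (a x) * a y) (k y)⟫_ℂ else 0) =
      ∑ q ∈ P.image r, ⟪if r x = q then k x else 0,
        φ (star (a x) * a y) (if r y = q then k y else 0)⟫_ℂ := by
    intro x hx y
    rw [Finset.sum_eq_single_of_mem (r x) (Finset.mem_image_of_mem r hx)]
    · by_cases h : r x = r y
      · simp [h]
      · simp [h, Ne.symm h]
    · intro q _ hq
      simp [Ne.symm hq]
  rw [Finset.sum_congr rfl fun x hx => Finset.sum_congr rfl fun y _ => h1 x hx y]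
  simp only [Finset.sum_comm (t := P.image r)]
  refine Finset.sum_nonneg fun q _ => ?_
  have := φ.sum_inner_nonneg (fun x : P => a x) fun x : P => if r x = q then k x else 0
  rw [← Finset.sum_coe_sort P]
  simp_rw [← Finset.sum_coe_sort P]
  exact this

/-! ### Induced maps of sections and coefficients -/

namespace FellBundle

open scoped Classical

variable {G : Type*} [Group G] {B C : FellBundle G}

/-- The map of sections that is given by `ψ g` on the fibre over `g`. -/
def sectionMap (ψ : ∀ g, B.fiber g →ₗ[ℂ] C.fiber g) : B.Cc →ₗ[ℂ] C.Cc :=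
  DFinsupp.mapRange.linearMap ψ

theorem sectionMap_single (ψ : ∀ g, B.fiber g →ₗ[ℂ] C.fiber g) (g : G) (b : B.fiber g) :
    sectionMap ψ (Cc.single B g b) = Cc.single C g (ψ g b) :=
  DFinsupp.mapRange_single (f := fun g => ψ g) (hf := fun g => map_zero (ψ g))

/-- A family of maps into a representation of `C` that takes `B_g` into the image of `C_g` comes
from linear maps `B_g → C_g`, if the representation is faithful. -/
theorem Rep.IsFaithful.exists_linearMap {π : C.Rep (H →L[ℂ] H)} (hπ : π.IsFaithful)
    (φ : ∀ g, B.fiber g →ₗ[ℂ] (H →L[ℂ] H)) (hφ : ∀ g b, ∃ c : C.fiber g, φ g b = π.map g c) :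
    ∃ ψ : ∀ g, B.fiber g →ₗ[ℂ] C.fiber g, ∀ g b, π.map g (ψ g b) = φ g b := by
  choose c hc using hφ
  refine ⟨fun g =>
    { toFun := c g
      map_add' := fun b b' => hπ.injective g (by rw [map_add, ← hc, ← hc, ← hc, map_add])
      map_smul' := fun z b => hπ.injective g
        (by rw [RingHom.id_apply, map_smul, ← hc, ← hc, map_smul]) },
    fun g b => (hc g b).symm⟩

variable (π : C.Rep (H →L[ℂ] H))

/-- The functional `x ↦ ⟨h, π(⟨ξ, x * ζ⟩) h⟩`, a coefficient of the left regular representation,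
on the sections of `C`. -/
def coefficient (h : H) (ξ ζ : C.Cc) : C.Cc →ₗ[ℂ] ℂ where
  toFun x := ⟪h, π.unitHom (C.inner ξ (x * ζ)) h⟫_ℂ
  map_add' x y := by
    rw [add_mul, inner_add_right, map_add, add_apply, _root_.inner_add_right]
  map_smul' c x := by
    rw [smul_mul_assoc, inner_smul_right, map_smul, smul_apply,
      _root_.inner_smul_right]
    rfl

theorem coefficient_apply (h : H) (ξ ζ x : C.Cc) :
    coefficient π h ξ ζ x = ⟪h, π.unitHom (C.inner ξ (x * ζ)) h⟫_ℂ := rfl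

theorem coefficient_sum_left {J : Type*} (s : Finset J) (h : H) (ξ : J → C.Cc) (ζ x : C.Cc) :
    coefficient π h (∑ j ∈ s, ξ j) ζ x = ∑ j ∈ s, coefficient π h (ξ j) ζ x :=
  map_sum (AddMonoidHom.mk' (fun ξ => coefficient π h ξ ζ x) fun ξ ξ' => by
    rw [coefficient_apply, inner_add_left, map_add, add_apply,
      _root_.inner_add_right]
    rfl) ξ s

theorem coefficient_sum_right {J : Type*} (s : Finset J) (h : H) (ξ : C.Cc) (ζ : J → C.Cc)
    (x : C.Cc) :
    coefficient π h ξ (∑ j ∈ s, ζ j) x = ∑ j ∈ s, coefficient π h ξ (ζ j) x :=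
  map_sum (AddMonoidHom.mk' (fun ζ => coefficient π h ξ ζ x) fun ζ ζ' => by
    rw [coefficient_apply, mul_add, inner_add_right, map_add, add_apply,
      _root_.inner_add_right]
    rfl) ζ s

theorem coefficient_single (h : H) {s g t : G} (c : C.fiber s) (y : C.fiber g) (d : C.fiber t) :
    coefficient π h (Cc.single C s c) (Cc.single C t d) (Cc.single C g y) =
      if s = g * t then ⟪π.map s c h, π.map g y (π.map t d h)⟫_ℂ else 0 := by
  rw [coefficient_apply, FellBundle.inner, Cc.star_single, Cc.single_mul_single,
    Cc.single_mul_single, π.unitHom_evalUnit_single, inv_mul_eq_one]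
  split_ifs with hs
  · rw [π.map_mul, π.map_star, π.map_mul, mul_apply_eq_comp,
      mul_apply_eq_comp, ContinuousLinearMap.star_eq_adjoint,
      ContinuousLinearMap.adjoint_inner_right]
  · simp

variable {π} {φ : CompletelyPositiveMap B.FullCStar (H →L[ℂ] H)}
  {ψ : ∀ g, B.fiber g →ₗ[ℂ] C.fiber g}

theorem toFull_star {g : G} (b : B.fiber g) : B.toFull g⁻¹ (B.fstar b) = star (B.toFull g b) := by
  change B.fullSeminorm.toCompletion (Cc.single B g⁻¹ (B.fstar b)) = _
  rw [← Cc.star_single, CStarSeminorm.toCompletion_star]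
  rfl

theorem toFull_fmul {g h : G} (a : B.fiber g) (b : B.fiber h) :
    B.toFull (g * h) (B.fmul a b) = B.toFull g a * B.toFull h b := by
  change B.fullSeminorm.toCompletion (Cc.single B (g * h) (B.fmul a b)) = _
  rw [← Cc.single_mul_single, CStarSeminorm.toCompletion_mul]
  rfl

theorem norm_toFull_le {g : G} (b : B.fiber g) : ‖B.toFull g b‖ ≤ ‖b‖ :=
  (B.fullSeminorm.norm_toCompletion _).trans_le (seminorm_single_le _ b)

theorem sectionMap_star (hπ : π.IsFaithful) (hψ : ∀ g b, π.map g (ψ g b) = φ (B.toFull g b))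
    (f : B.Cc) : sectionMap ψ (star f) = star (sectionMap ψ f) := by
  induction f using Cc.induction with
  | h₀ => simp
  | h₂ f f' hf hf' => simp only [star_add, map_add, hf, hf']
  | h₁ g b =>
    rw [Cc.star_single, sectionMap_single, sectionMap_single, Cc.star_single]
    congr 1
    apply hπ.injective
    rw [hψ, π.map_star, hψ, toFull_star, map_star]

theorem coefficient_sectionMap_single (hψ : ∀ g b, π.map g (ψ g b) = φ (B.toFull g b)) (h : H)
    {s g t : G} (c : C.fiber s) (b : B.fiber g) (d : C.fiber t) :
    coefficient π h (Cc.single C s c) (Cc.single C t d) (sectionMap ψ (Cc.single B g b)) =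
      if s = g * t then ⟪π.map s c h, φ (B.toFull g b) (π.map t d h)⟫_ℂ else 0 := by
  rw [sectionMap_single, coefficient_single, hψ]

/-- The kernel of `φ` appears in the coefficients; the condition `u⁻¹ v = s t⁻¹` for a nonzero term is
symmetric in the form `u s = v t`. -/
theorem coefficient_sectionMap_star_mul_single
    (hψ : ∀ g b, π.map g (ψ g b) = φ (B.toFull g b)) (h : H) {u v s t : G} (a : B.fiber u)
    (b : B.fiber v) (c : C.fiber s) (d : C.fiber t) :
    coefficient π h (Cc.single C s c) (Cc.single C t d)
        (sectionMap ψ (star (Cc.single B u a) * Cc.single B v b)) =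
      if u * s = v * t then
        ⟪π.map s c h, φ (star (B.toFull u a) * B.toFull v b) (π.map t d h)⟫_ℂ else 0 := by
  rw [Cc.star_single, Cc.single_mul_single, coefficient_sectionMap_single hψ, toFull_fmul,
    toFull_star, mul_assoc]
  simp only [eq_inv_mul_iff_mul_eq]

/-- Complete positivity of the induced map of sections, tested on the left regular representation.
Expanding all sections into their values `a` at `u` and `c` at `s`, the double sum becomes block
diagonal with respect to the label `u s`, and each block is positive by complete positivity. -/
theorem sum_coefficient_sectionMap_nonneg (hψ : ∀ g b, π.map g (ψ g b) = φ (B.toFull g b))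
    {J : Type*} [Fintype J] (h : H) (n : J → B.Cc) (ξ : J → C.Cc) :
    0 ≤ ∑ i, ∑ j, coefficient π h (ξ i) (ξ j) (sectionMap ψ (star (n i) * n j)) := by
  let P : Finset (Σ _ : J, G × G) := Finset.univ.sigma fun i => (n i).support ×ˢ (ξ i).support
  have key := φ.sum_ite_inner_nonneg P (fun x => x.2.1 * x.2.2)
    (fun x => B.toFull x.2.1 (Cc.eval B x.2.1 (n x.1)))
    (fun x => π.map x.2.2 (Cc.eval C x.2.2 (ξ x.1)) h)
  refine key.trans_eq ?_
  simp only [← coefficient_sectionMap_star_mul_single hψ]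
  simp only [P, Finset.sum_sigma, Finset.sum_product]
  refine Finset.sum_congr rfl fun i _ => ?_
  simp only [Finset.sum_comm (s := (ξ i).support) (t := Finset.univ (α := J)),
    Finset.sum_comm (s := (n i).support) (t := Finset.univ (α := J))]
  refine Finset.sum_congr rfl fun j _ => ?_
  conv_rhs => rw [← sum_single_support (n i), ← sum_single_support (n j), star_sum,
    Finset.sum_mul_sum, map_sum, map_sum]
  refine Finset.sum_congr rfl fun u _ => ?_
  conv_rhs => rw [map_sum, map_sum]
  rw [Finset.sum_comm]
  refine Finset.sum_congr rfl fun v _ => ?_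
  conv_rhs => rw [← sum_single_support (ξ i), ← sum_single_support (ξ j), coefficient_sum_left]
  refine Finset.sum_congr rfl fun s _ => ?_
  rw [coefficient_sum_right]

theorem coefficient_eq_sum (h : H) (ξ ζ x : C.Cc) :
    coefficient π h ξ ζ x = ∑ s ∈ ξ.support, ∑ t ∈ ζ.support, coefficient π h
      (Cc.single C s (Cc.eval C s ξ)) (Cc.single C t (Cc.eval C t ζ)) x := by
  conv_lhs => rw [← sum_single_support ξ, ← sum_single_support ζ, coefficient_sum_left]
  simp only [coefficient_sum_right]

/-- The functional `f ↦ ⟨h, π(⟨ξ, ψ(f) * ζ⟩) h⟩` depends on finitely many values of `f` only; hence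
it is bounded for the reduced norm. -/
theorem exists_norm_coefficient_sectionMap_le (hψ : ∀ g b, π.map g (ψ g b) = φ (B.toFull g b))
    (h : H) (ξ ζ : C.Cc) : ∃ K : ℝ, ∀ f : B.Cc,
      ‖coefficient π h ξ ζ (sectionMap ψ f)‖ ≤ K * B.reducedSeminorm.toSeminorm f := by
  have hsingle : ∀ (s t : G) (c : C.fiber s) (d : C.fiber t) (f : B.Cc),
      coefficient π h (Cc.single C s c) (Cc.single C t d) (sectionMap ψ f) =
        ⟪π.map s c h, φ (B.toFull (s * t⁻¹) (Cc.eval B (s * t⁻¹) f)) (π.map t d h)⟫_ℂ := by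
    intro s t c d f
    induction f using Cc.induction with
    | h₀ => simp
    | h₂ f f' hf hf' =>
      simp only [map_add, hf, hf', add_apply, _root_.inner_add_right]
    | h₁ g b =>
      rw [coefficient_sectionMap_single hψ]
      split_ifs with hs
      · have hg : s * t⁻¹ = g := by rw [hs, mul_inv_cancel_right]
        rw [hg, Cc.eval_single_same]
      · rw [Cc.eval_single_ne (fun hg => hs (by rw [hg, inv_mul_cancel_right]))]
        simp
  refine ⟨∑ s ∈ ξ.support, ∑ t ∈ ζ.support, ‖π.map s (Cc.eval C s ξ) h‖ *
    (‖φ.toCLM‖ * ‖π.map t (Cc.eval C t ζ) h‖), fun f => ?_⟩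
  rw [coefficient_eq_sum, Finset.sum_mul]
  refine (norm_sum_le _ _).trans (Finset.sum_le_sum fun s _ => ?_)
  rw [Finset.sum_mul]
  refine (norm_sum_le _ _).trans (Finset.sum_le_sum fun t _ => ?_)
  rw [hsingle]
  set b := Cc.eval B (s * t⁻¹) f
  have h1 : ‖φ (B.toFull (s * t⁻¹) b)‖ ≤ ‖φ.toCLM‖ * B.reducedSeminorm.toSeminorm f :=
    (φ.toCLM.le_opNorm _).trans (mul_le_mul_of_nonneg_left
      ((norm_toFull_le b).trans (norm_eval_le_reducedSeminorm _ f)) (norm_nonneg _))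
  refine (norm_inner_le_norm _ _).trans ?_
  rw [mul_assoc, mul_right_comm]
  exact mul_le_mul_of_nonneg_left ((ContinuousLinearMap.le_opNorm _ _).trans
    (mul_le_mul_of_nonneg_right h1 (norm_nonneg _))) (norm_nonneg _)

/-- On the unit fibre only the terms with `s = t` of the double sum over the supports survive, which
gives an explicit bound. -/
theorem coefficient_sectionMap_incl_le (hψ : ∀ g b, π.map g (ψ g b) = φ (B.toFull g b)) (h : H)
    (ξ : C.Cc) (a : B.unitFiber) :
    (coefficient π h ξ ξ (sectionMap ψ (unitFiber.incl B a))).re ≤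
      ‖φ.toCLM‖ * ‖a‖ * (⟪h, π.unitHom (C.inner ξ ξ) h⟫_ℂ).re := by
  have h1 : coefficient π h ξ ξ (sectionMap ψ (unitFiber.incl B a)) =
      ∑ s ∈ ξ.support, ⟪π.map s (Cc.eval C s ξ) h,
        φ (B.toFull 1 a) (π.map s (Cc.eval C s ξ) h)⟫_ℂ := by
    rw [coefficient_eq_sum]
    refine Finset.sum_congr rfl fun s hs => ?_
    rw [Finset.sum_eq_single_of_mem s hs]
    · refine (coefficient_sectionMap_single hψ h _ (g := 1) a _).trans ?_
      rw [if_pos (one_mul s).symm]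
    · intro t _ hts
      refine (coefficient_sectionMap_single hψ h _ (g := 1) a _).trans ?_
      rw [if_neg (by rw [one_mul]; exact hts.symm)]
  have h2 : ⟪h, π.unitHom (C.inner ξ ξ) h⟫_ℂ =
      ∑ s ∈ ξ.support, ((‖π.map s (Cc.eval C s ξ) h‖ ^ 2 : ℝ) : ℂ) := by
    rw [inner_eq_sum, map_sum, sum_apply, inner_sum]
    refine Finset.sum_congr rfl fun s _ => ?_
    rw [π.unitHom_starMul, mul_apply_eq_comp, ContinuousLinearMap.star_eq_adjoint,
      ContinuousLinearMap.adjoint_inner_right, inner_self_eq_norm_sq_to_K]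
    simp
  rw [h1, h2, Complex.re_sum, Complex.re_sum, Finset.mul_sum]
  refine Finset.sum_le_sum fun s _ => ?_
  rw [Complex.ofReal_re]
  set k := π.map s (Cc.eval C s ξ) h
  calc _ ≤ ‖⟪k, φ (B.toFull 1 a) k⟫_ℂ‖ := Complex.re_le_norm _
    _ ≤ ‖k‖ * ‖φ (B.toFull 1 a) k‖ := norm_inner_le_norm _ _
    _ ≤ ‖k‖ * (‖φ.toCLM‖ * ‖a‖ * ‖k‖) := by
      gcongr
      refine (ContinuousLinearMap.le_opNorm _ _).trans ?_
      gcongr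
      exact (φ.toCLM.le_opNorm _).trans (by gcongr; exact norm_toFull_le (g := 1) a)
    _ = _ := by ring

/-! ### Positivity and boundedness for the reduced norms -/

theorem exists_unitHom_inner_self (π : C.Rep (H →L[ℂ] H)) (ξ : C.Cc) : ∃ S : H →L[ℂ] H,
    (∀ h, ⟪h, π.unitHom (C.inner ξ ξ) h⟫_ℂ = ((‖S h‖ ^ 2 : ℝ) : ℂ)) ∧
      ‖π.unitHom (C.inner ξ ξ)‖ = ‖S‖ ^ 2 := by
  obtain ⟨c, hc⟩ := CStarAlgebra.exists_eq_star_mul_self_of_nonneg (inner_self_nonneg ξ)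
  have hS : π.unitHom (C.inner ξ ξ) = star (π.unitHom c) * π.unitHom c := by
    rw [hc, map_mul, map_star]
  refine ⟨π.unitHom c, fun h => ?_, ?_⟩
  · rw [hS, mul_apply_eq_comp, ContinuousLinearMap.star_eq_adjoint,
      ContinuousLinearMap.adjoint_inner_right, inner_self_eq_norm_sq_to_K]
    simp
  · rw [hS, sq]; exact CStarRing.norm_star_mul_self

theorem inner_unitHom_inner_self_nonneg (π : C.Rep (H →L[ℂ] H)) (ξ : C.Cc) (h : H) :
    0 ≤ ⟪h, π.unitHom (C.inner ξ ξ) h⟫_ℂ := by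
  obtain ⟨S, hS, -⟩ := exists_unitHom_inner_self π ξ
  rw [hS]
  exact_mod_cast sq_nonneg ‖S h‖

/-- A faithful representation computes the norm of `ℓ²(C)` through quadratic forms. -/
theorem norm_inner_self_le_of_forall (hπ : π.IsFaithful) (ξ : C.Cc) {K : ℝ} (hK : 0 ≤ K)
    (h : ∀ h, (⟪h, π.unitHom (C.inner ξ ξ) h⟫_ℂ).re ≤ K * ‖h‖ ^ 2) : ‖C.inner ξ ξ‖ ≤ K := by
  obtain ⟨S, hS, hn⟩ := exists_unitHom_inner_self π ξ
  rw [← hπ.norm_unitHom, hn]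
  refine (pow_le_pow_left₀ (norm_nonneg S) (S.opNorm_le_bound (Real.sqrt_nonneg K) fun x => ?_)
    2).trans (Real.sq_sqrt hK).le
  refine le_of_sq_le_sq ?_ (by positivity)
  have := h x
  rw [hS, Complex.ofReal_re] at this
  rwa [mul_pow, Real.sq_sqrt hK]

theorem coefficient_star_mul_self (h : H) (ξ x : C.Cc) :
    coefficient π h ξ ξ (star x * x) = ⟪h, π.unitHom (C.inner (x * ξ) (x * ξ)) h⟫_ℂ := by
  rw [coefficient_apply, mul_assoc, inner_mul_left, star_star]

theorem coefficient_star_mul_mul (h : H) (ξ y z x : C.Cc) :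
    coefficient π h ξ ξ (star y * x * z) = coefficient π h (y * ξ) (z * ξ) x := by
  rw [coefficient_apply, mul_assoc, mul_assoc, inner_mul_left, star_star, ← mul_assoc, mul_assoc]
  rfl

theorem norm_coefficient_le (hπ : π.IsFaithful) (h : H) (ξ x : C.Cc) :
    ‖coefficient π h ξ ξ x‖ ≤
      ‖h‖ ^ 2 * ‖(show C.PreL2 from ξ)‖ ^ 2 * C.reducedSeminorm.toSeminorm x := by
  set m := ‖(show C.PreL2 from ξ)‖
  have h1 : ‖C.inner ξ (x * ξ)‖ ≤ m * (C.reducedSeminorm.toSeminorm x * m) :=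
    (norm_inner_le (show C.PreL2 from ξ) (show C.PreL2 from x * ξ)).trans
      (mul_le_mul_of_nonneg_left (norm_preRegular_apply_le x ξ) (norm_nonneg _))
  rw [← hπ.norm_unitHom] at h1
  calc ‖coefficient π h ξ ξ x‖ ≤ ‖h‖ * ‖π.unitHom (C.inner ξ (x * ξ)) h‖ := norm_inner_le_norm _ _
    _ ≤ ‖h‖ * (m * (C.reducedSeminorm.toSeminorm x * m) * ‖h‖) := by
      gcongr
      exact (ContinuousLinearMap.le_opNorm _ _).trans (by gcongr)
    _ = _ := by ring

/-- The functionals `coefficient π h ξ ξ` extend to a separating family of positive functionals on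
the reduced cross-sectional C⋆-algebra. -/
theorem exists_separating_functionals (hπ : π.IsFaithful) :
    ∃ θ : H × C.Cc → C.ReducedCStar →L[ℂ] ℂ,
      (∀ i x, θ i (C.reducedSeminorm.toCompletion x) = coefficient π i.1 i.2 i.2 x) ∧
      (∀ i a, 0 ≤ θ i (star a * a)) ∧ ∀ a, (∀ i, θ i (star a * a) = 0) → a = 0 := by
  choose θ hθ hθn using fun i : H × C.Cc => C.reducedSeminorm.exists_extension
    (coefficient π i.1 i.2 i.2) (norm_coefficient_le hπ i.1 i.2)
  refine ⟨θ, hθ, fun i a => ?_, fun a ha => ?_⟩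
  · refine C.reducedSeminorm.induction_on (P := fun a => 0 ≤ θ i (star a * a)) a
      (isClosed_le continuous_const (by fun_prop)) fun x => ?_
    rw [← CStarSeminorm.toCompletion_star, ← CStarSeminorm.toCompletion_mul, hθ,
      coefficient_star_mul_self]
    exact inner_unitHom_inner_self_nonneg π _ _
  · -- by density of the sections, `‖y‖² ≤ ‖y⋆ y - a⋆ a‖` for all `y`, and `y = a` gives `a = 0`
    have key : ‖a‖ ^ 2 ≤ ‖star a * a - star a * a‖ := by
      refine C.reducedSeminorm.induction_on (P := fun y => ‖y‖ ^ 2 ≤ ‖star y * y - star a * a‖) a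
        (isClosed_le (by fun_prop) (by fun_prop)) fun x => ?_
      set X := C.reducedSeminorm.toCompletion x with hX
      set δ := ‖star X * X - star a * a‖
      have hreg : ‖preRegular x‖ ≤ √δ := by
        refine (preRegular x).opNorm_le_bound (Real.sqrt_nonneg δ) fun ξ => ?_
        refine le_of_sq_le_sq ?_ (by positivity)
        rw [norm_sq_preL2, mul_pow, Real.sq_sqrt (norm_nonneg _)]
        refine norm_inner_self_le_of_forall hπ (x * (show C.Cc from ξ)) (by positivity) fun h => ?_
        rw [← coefficient_star_mul_self, ← hθ (h, ξ), CStarSeminorm.toCompletion_mul,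
          CStarSeminorm.toCompletion_star, ← hX, ← sub_zero (θ (h, ξ) (star X * X)), ← ha (h, ξ),
          ← map_sub]
        refine (Complex.re_le_norm _).trans ((hθn _ _).trans_eq ?_)
        change ‖h‖ ^ 2 * ‖ξ‖ ^ 2 * δ = _
        ring
      have hXn : ‖X‖ = ‖preRegular x‖ := (C.reducedSeminorm.norm_toCompletion x).trans
        (norm_regular x)
      rw [hXn]
      exact (pow_le_pow_left₀ (norm_nonneg _) hreg 2).trans (Real.sq_sqrt (norm_nonneg _)).le
    rw [sub_self, norm_zero] at key
    exact norm_eq_zero.mp (pow_eq_zero_iff two_ne_zero |>.mp (le_antisymm key (sq_nonneg _)))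

open CStarAlgebra in
/-- The induced map of sections is bounded for the reduced norms. For `η = ψ(f) * ξ` the Cauchy–
Schwarz type estimate for the kernel of the coefficients of `η` and `ξ` bounds the square of
`q = ⟨h, π(⟨η, η⟩) h⟩` by a multiple of `q` itself. -/
theorem reducedSeminorm_sectionMap_le (hπ : π.IsFaithful)
    (hψ : ∀ g b, π.map g (ψ g b) = φ (B.toFull g b)) (f : B.Cc) :
    C.reducedSeminorm.toSeminorm (sectionMap ψ f) ≤
      ‖φ.toCLM‖ * B.reducedSeminorm.toSeminorm f := by
  set m := ‖φ.toCLM‖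
  set F := B.reducedSeminorm.toSeminorm f with hF
  have hF0 : 0 ≤ F := B.reducedSeminorm.nonneg f
  change ‖regular _‖ ≤ _
  rw [norm_regular]
  refine ContinuousLinearMap.opNorm_le_bound _ (by positivity) fun ξ => ?_
  refine le_of_sq_le_sq ?_ (by positivity)
  rw [norm_sq_preL2]
  set η : C.Cc := sectionMap ψ f * (show C.Cc from ξ) with hη
  change ‖C.inner η η‖ ≤ _
  refine norm_inner_self_le_of_forall hπ η (by positivity) fun h => ?_
  set q := (⟪h, π.unitHom (C.inner η η) h⟫_ℂ).re with hq
  have hq0 : 0 ≤ q := (Complex.le_def.mp (inner_unitHom_inner_self_nonneg π η h)).1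
  -- the functionals `f ↦ ⟨h, π(⟨v a, ψ(f) * v b⟩) h⟩` for the two vectors `η` and `ξ`
  let v : Fin 2 → C.Cc := ![η, ξ]
  choose K hK using fun a b => exists_norm_coefficient_sectionMap_le hψ h (v a) (v b)
  choose ω hω hωn using fun a b => B.reducedSeminorm.exists_extension
    (coefficient π h (v a) (v b) ∘ₗ sectionMap ψ) (hK a b)
  have hpos : ∀ x : Fin 2 → B.ReducedCStar, 0 ≤ ∑ a, ∑ b, ω a b (star (x a) * x b) := by
    intro x
    refine B.reducedSeminorm.induction_on_pi
      (P := fun x => 0 ≤ ∑ a, ∑ b, ω a b (star (x a) * x b)) x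
      (isClosed_le continuous_const (by fun_prop)) fun n => ?_
    simp only [← CStarSeminorm.toCompletion_star, ← CStarSeminorm.toCompletion_mul, hω]
    exact sum_coefficient_sectionMap_nonneg hψ h n v
  have hdiag : ∀ a, ∀ᶠ e in approximateUnit B.unitFiber,
      (ω a a (B.reducedSeminorm.toCompletion (unitFiber.incl B e) *
        B.reducedSeminorm.toCompletion (unitFiber.incl B e))).re ≤
          m * (⟪h, π.unitHom (C.inner (v a) (v a)) h⟫_ℂ).re := by
    intro a
    filter_upwards [eventually_approximateUnit B] with e he
    rw [← CStarSeminorm.toCompletion_mul, ← unitFiber.incl_mul, hω]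
    refine (coefficient_sectionMap_incl_le hψ h (v a) (e * e)).trans ?_
    refine mul_le_mul_of_nonneg_right ?_
      (Complex.le_def.mp (inner_unitHom_inner_self_nonneg π (v a) h)).1
    refine mul_le_of_le_one_right (norm_nonneg _) ((norm_mul_le e e).trans ?_)
    exact mul_le_one₀ he.2 (norm_nonneg _) he.2
  have hmain := norm_sq_le_of_kernel_nonneg_of_tendsto
    (fun e => B.reducedSeminorm.toCompletion (unitFiber.incl B e))
    (tendsto_incl_mul B.reducedSeminorm)
    ((eventually_approximateUnit B).mono fun e he => by
      rw [← CStarSeminorm.toCompletion_star, ← unitFiber.incl_star, he.1])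
    ((eventually_approximateUnit B).mono fun e he => (norm_toCompletion_incl_le _ e).trans he.2)
    ω hpos (hdiag 0) (hdiag 1) (B.reducedSeminorm.toCompletion f)
  rw [hω, CStarSeminorm.norm_toCompletion, ← hF] at hmain
  have hqle : q ≤ ‖coefficient π h η ξ (sectionMap ψ f)‖ := Complex.re_le_norm _
  set q' := (⟪h, π.unitHom (C.inner ξ ξ) h⟫_ℂ).re with hq'
  have hq'le : q' ≤ ‖ξ‖ ^ 2 * ‖h‖ ^ 2 := by
    have h1 : ‖π.unitHom (C.inner ξ ξ)‖ = ‖ξ‖ ^ 2 :=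
      (hπ.norm_unitHom _).trans (norm_sq_preL2 C ξ).symm
    calc q' ≤ ‖h‖ * ‖π.unitHom (C.inner ξ ξ) h‖ :=
          (Complex.re_le_norm _).trans (norm_inner_le_norm _ _)
      _ ≤ ‖h‖ * (‖ξ‖ ^ 2 * ‖h‖) := by
        rw [← h1]; gcongr; exact ContinuousLinearMap.le_opNorm _ _
      _ = _ := by ring
  have hsq : q ^ 2 ≤ m * q * (m * q' * F ^ 2) := (pow_le_pow_left₀ hq0 hqle 2).trans hmain
  have hbd : q ≤ (m * F) ^ 2 * q' := by
    rcases hq0.eq_or_lt with h0 | h0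
    · rw [← h0]
      exact mul_nonneg (sq_nonneg _)
        (Complex.le_def.mp (inner_unitHom_inner_self_nonneg π (show C.Cc from ξ) h)).1
    · refine le_of_mul_le_mul_left ?_ h0
      linarith [hsq, show q * ((m * F) ^ 2 * q') = m * q * (m * q' * F ^ 2) by ring]
  calc q ≤ (m * F) ^ 2 * q' := hbd
    _ ≤ (m * F) ^ 2 * (‖ξ‖ ^ 2 * ‖h‖ ^ 2) := by gcongr
    _ = _ := by ring

/-- The induced map of sections is completely positive for the reduced completion of `C`. -/
theorem cstarMatrix_sectionMap_nonneg (hπ : π.IsFaithful)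
    (hψ : ∀ g b, π.map g (ψ g b) = φ (B.toFull g b)) {J : Type*} [Fintype J] (n : J → B.Cc) :
    0 ≤ (CStarMatrix.ofMatrix fun i j =>
      C.reducedSeminorm.toCompletion (sectionMap ψ (star (n i) * n j)) :
        CStarMatrix J J C.ReducedCStar) := by
  obtain ⟨θ, hθ, hθpos, hsep⟩ := exists_separating_functionals hπ
  refine CStarMatrix.nonneg_of_forall_sum_nonneg (fun i => (θ i : C.ReducedCStar →ₗ[ℂ] ℂ)) hθpos
    hsep _ ?_ fun i ζ => ?_
  · ext j k
    rw [CStarMatrix.star_apply]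
    change star (C.reducedSeminorm.toCompletion (sectionMap ψ (star (n k) * n j))) =
      C.reducedSeminorm.toCompletion (sectionMap ψ (star (n j) * n k))
    rw [← CStarSeminorm.toCompletion_star, ← sectionMap_star hπ hψ, star_mul, star_star]
  · change 0 ≤ ∑ j, ∑ k, θ i (star (ζ j) *
      C.reducedSeminorm.toCompletion (sectionMap ψ (star (n j) * n k)) * ζ k)
    refine C.reducedSeminorm.induction_on_pi (P := fun ζ => 0 ≤ ∑ j, ∑ k, θ i (star (ζ j) *
      C.reducedSeminorm.toCompletion (sectionMap ψ (star (n j) * n k)) * ζ k)) ζ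
      (isClosed_le continuous_const (by fun_prop)) fun z => ?_
    simp only [← CStarSeminorm.toCompletion_star, ← CStarSeminorm.toCompletion_mul, hθ,
      coefficient_star_mul_mul]
    exact sum_coefficient_sectionMap_nonneg hψ i.1 n fun j => z j * i.2

open CStarAlgebra in
/-- A completely positive map on the full cross-sectional algebra is bounded by any bound for its
restriction to the unit fibre, since this contains an approximate unit. -/
theorem norm_apply_le_of_forall_incl (φ : CompletelyPositiveMap B.FullCStar (H →L[ℂ] H)) {m : ℝ}
    (hm : 0 ≤ m) (h : ∀ a : B.fiber 1, ‖φ (B.toFull 1 a)‖ ≤ m * ‖a‖) (x : B.FullCStar) :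
    ‖φ x‖ ≤ m * ‖x‖ := by
  have hsesq : ∀ k h, ‖⟪k, φ x h⟫_ℂ‖ ^ 2 ≤ m * ‖k‖ ^ 2 * (m * ‖h‖ ^ 2 * ‖x‖ ^ 2) := by
    intro k h'
    let v : Fin 2 → H := ![k, h']
    let ω : Fin 2 → Fin 2 → B.FullCStar →L[ℂ] ℂ := fun a b =>
      innerSL ℂ (v a) ∘L ContinuousLinearMap.apply ℂ H (v b) ∘L φ.toCLM
    have hdiag : ∀ a, ∀ᶠ e in approximateUnit B.unitFiber,
        (ω a a (B.fullSeminorm.toCompletion (unitFiber.incl B e) *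
          B.fullSeminorm.toCompletion (unitFiber.incl B e))).re ≤ m * ‖v a‖ ^ 2 := by
      intro a
      filter_upwards [eventually_approximateUnit B] with e he
      rw [← CStarSeminorm.toCompletion_mul, ← unitFiber.incl_mul]
      change (⟪v a, φ (B.toFull 1 (e * e)) (v a)⟫_ℂ).re ≤ _
      have h1 : ‖φ (B.toFull 1 (e * e))‖ ≤ m := (h (e * e : B.unitFiber)).trans
        (mul_le_of_le_one_right hm
          ((norm_mul_le e e).trans (mul_le_one₀ he.2 (norm_nonneg _) he.2)))
      calc _ ≤ ‖v a‖ * ‖φ (B.toFull 1 (e * e)) (v a)‖ :=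
            (Complex.re_le_norm _).trans (norm_inner_le_norm _ _)
        _ ≤ ‖v a‖ * (m * ‖v a‖) := by
          gcongr
          exact (ContinuousLinearMap.le_opNorm _ _).trans (by gcongr)
        _ = _ := by ring
    exact norm_sq_le_of_kernel_nonneg_of_tendsto
      (fun e => B.fullSeminorm.toCompletion (unitFiber.incl B e))
      (tendsto_incl_mul B.fullSeminorm)
      ((eventually_approximateUnit B).mono fun e he => by
        rw [← CStarSeminorm.toCompletion_star, ← unitFiber.incl_star, he.1])
      ((eventually_approximateUnit B).mono fun e he => (norm_toCompletion_incl_le _ e).trans he.2)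
      ω (fun y => φ.sum_inner_nonneg y v) (hdiag 0) (hdiag 1) x
  refine (φ x).opNorm_le_bound (by positivity) fun h' => ?_
  -- the choice `k = φ x h'` makes the left hand side `‖φ x h'‖ ^ 4`
  have h1 := hsesq (φ x h') h'
  rw [inner_self_eq_norm_sq_to_K, norm_pow, RCLike.norm_ofReal, abs_norm] at h1
  rcases (norm_nonneg (φ x h')).eq_or_lt with h0 | h0
  · rw [← h0]; positivity
  · refine le_of_sq_le_sq ?_ (by positivity)
    refine le_of_mul_le_mul_left ?_ (pow_pos h0 2)
    calc _ = (‖φ x h'‖ ^ 2) ^ 2 := by ring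
      _ ≤ _ := h1
      _ = _ := by ring

end FellBundle

end

theorem mainTheorem5 {G : Type*} [Group G] (B : FellBundle G) (C : FellBundle G)
    {H : Type*} [NormedAddCommGroup H] [InnerProductSpace ℂ H] [CompleteSpace H]
    (π : C.Rep (H →L[ℂ] H)) (hπ : π.IsFaithful)
    (φ : CompletelyPositiveMap B.FullCStar (H →L[ℂ] H))
    (hφ : ∀ (g : G) (b : B.fiber g), ∃ c : C.fiber g, φ (B.toFull g b) = π.map g c) :
    ∃ φ' : CompletelyPositiveMap B.ReducedCStar C.ReducedCStar,
      ‖φ'.toCLM‖ = ‖φ.toCLM‖ ∧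
      ∀ (g : G) (b : B.fiber g), ∃ c : C.fiber g,
        φ' (B.toReduced g b) = C.toReduced g c ∧ π.map g c = φ (B.toFull g b) := by
  obtain ⟨ψ, hψ⟩ := hπ.exists_linearMap (fun g => (φ : B.FullCStar →ₗ[ℂ] (H →L[ℂ] H)) ∘ₗ B.toFull g)
    hφ
  replace hψ : ∀ g b, π.map g (ψ g b) = φ (B.toFull g b) := hψ
  obtain ⟨T, hT, hTn⟩ := B.reducedSeminorm.exists_extension
    (C.reducedSeminorm.toCompletion ∘ₗ FellBundle.sectionMap ψ) (K := ‖φ.toCLM‖) fun f =>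
      (C.reducedSeminorm.norm_toCompletion _).trans_le
        (FellBundle.reducedSeminorm_sectionMap_le hπ hψ f)
  let φ' : CompletelyPositiveMap B.ReducedCStar C.ReducedCStar :=
    { (T : B.ReducedCStar →ₗ[ℂ] C.ReducedCStar) with
      map_cstarMatrix_nonneg' := fun k => B.reducedSeminorm.map_cstarMatrix_nonneg T fun n => by
        simp only [hT]
        exact FellBundle.cstarMatrix_sectionMap_nonneg hπ hψ n }
  have hφ' : ∀ g b, φ' (B.toReduced g b) = C.toReduced g (ψ g b) := fun g b =>
    (hT _).trans (congrArg C.reducedSeminorm.toCompletion (FellBundle.sectionMap_single ψ g b))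
  refine ⟨φ', le_antisymm ?_ ?_, fun g b => ⟨ψ g b, hφ' g b, hψ g b⟩⟩
  · exact ContinuousLinearMap.opNorm_le_bound _ (norm_nonneg _) hTn
  · -- on the unit fibre, `φ` and `φ'` are both `ψ 1` followed by an isometry
    refine ContinuousLinearMap.opNorm_le_bound _ (norm_nonneg _)
      (FellBundle.norm_apply_le_of_forall_incl φ (norm_nonneg _) fun a => ?_)
    rw [← hψ, hπ.norm_map]
    have h1 := FellBundle.norm_eval_le_reducedSeminorm 1 (FellBundle.Cc.single C 1 (ψ 1 a))
    rw [FellBundle.Cc.eval_single_same, ← CStarSeminorm.norm_toCompletion] at h1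
    refine h1.trans ((congrArg norm (hφ' 1 a)).ge.trans ((φ'.toCLM.le_opNorm _).trans ?_))
    exact mul_le_mul_of_nonneg_left
      (FellBundle.norm_toCompletion_incl_le B.reducedSeminorm a) (norm_nonneg _)
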